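/- Let $X$ and $Y$ be Polish spaces with locally finite Borel measures $\sigma$ on $X$ and $\mu$ on $Y$. Let $\Omega^X$ be the space of configurations on $X$, i.e. of locally finite point measures $\omega=\sum_{x\in\omega}\varepsilon_x$ (at most countable sums of Dirac masses, multiple points being allowed), with the $\sigma$-algebra generated by the maps $\omega\mapsto\omega(B)$, $B\subset X$ Borel; $\Omega^Y$ is defined in the same way. The Poisson measure $\pi_\sigma$ is the probability measure on $\Omega^X$ under which, for all pairwise disjoint Borel sets $B_1,\dots,B_p$ of finite $\sigma$-measure, $\omega(B_1),\dots,\omega(B_p)$ are independent Poisson random variables with parameters $\sigma(B_1),\dots,\sigma(B_p)$; $\pi_\mu$ on $\Omega^Y$ is defined in the same way. For $x_1,\dots,x_m\in X$, $\Theta\subset\{1,\dots,m\}$ and $F:\Omega^X\to\mathbb{R}$ let $$D_\Theta F(\omega)=\sum_{\eta\subset\Theta}(-1)^{|\Theta|-|\eta|}F\Big(\omega+\sum_{i\in\eta}\varepsilon_{x_i}\Big),$$ the iterated finite difference of $F$ at the points $x_i$, $i\in\Theta$. **Theorem.** Let $\tau:\Omega^X\times X\to Y$, $(\omega,x)\mapsto\tau(x,\omega)$,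 be a (jointly measurable) random transformation such that $\sigma\circ\tau(\cdot,\omega)^{-1}=\mu$ for every $\omega\in\Omega^X$, and such that $$D_{\Theta_1}\tau(x_1,\omega)\cdots D_{\Theta_m}\tau(x_m,\omega)=0$$ for all $m\ge1$, all $x_1,\dots,x_m\in X$, all $\omega\in\Omega^X$ and all non-empty sets $\Theta_1,\dots,\Theta_m$ with $\Theta_1\cup\cdots\cup\Theta_m=\{1,\dots,m\}$, which means that $$D_{\Theta_1}h_1(\tau(x_1,\omega))\cdots D_{\Theta_m}h_m(\tau(x_m,\omega))=0$$ for all bounded Borel functions $h_1,\dots,h_m:Y\to\mathbb{R}$. Then for $\pi_\sigma$-almost every $\omega$ the image measure $$\tau_*\omega=\sum_{x\in\omega}\varepsilon_{\tau(x,\omega)}=\omega\circ\tau(\cdot,\omega)^{-1}$$ belongs to $\Omega^Y$, the map $\tau_*$ is $\pi_\sigma$-measurable (i.e. it coincides $\pi_\sigma$-almost everywhere with a measurable map $\Omega^X\to\Omega^Y$), and $\tau_*\pi_\sigma$ is the Poisson measure $\pi_\mu$ with intensity $\mu$ on $Y$. -/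

import Mathlib

open MeasureTheory ProbabilityTheory
open scoped ENNReal NNReal

namespace PoissonTransform

/-- A Radon point measure: an at most countable sum of Dirac masses (repetitions allowed) that is
locally finite. On a Polish space every locally finite Borel measure is Radon. -/
def IsPointMeasure {X : Type*} [TopologicalSpace X] [MeasurableSpace X] (ω : Measure X) : Prop :=
  IsLocallyFiniteMeasure ω ∧
    ∃ (ι : Type) (_ : Countable ι) (x : ι → X), ω = Measure.sum fun i => Measure.dirac (x i)

/-- The configuration space `Ω^X`. As a subtype of `Measure X` it carries the σ-algebra generated
by the evaluations `ω ↦ ω B`, `B` a measurable subset of `X`. -/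
abbrev Configuration (X : Type*) [TopologicalSpace X] [MeasurableSpace X] : Type _ :=
  {ω : Measure X // IsPointMeasure ω}

section

variable {X : Type*} [TopologicalSpace X] [MeasurableSpace X]

theorem isPointMeasure_zero : IsPointMeasure (0 : Measure X) :=
  ⟨inferInstance, Empty, inferInstance, Empty.elim, by simp⟩

theorem IsPointMeasure.add_dirac {ω : Measure X} (hω : IsPointMeasure ω) (x : X) :
    IsPointMeasure (ω + Measure.dirac x) := by
  obtain ⟨hfin, ι, hι, y, hy⟩ := hω
  refine ⟨⟨fun z => ?_⟩, ι ⊕ Unit, inferInstance, Sum.elim y fun _ => x, ?_⟩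
  · obtain ⟨s, hs, hlt⟩ := hfin.finiteAtNhds z
    refine ⟨s, hs, ?_⟩
    rw [Measure.add_apply]
    exact ENNReal.add_lt_top.2 ⟨hlt, measure_lt_top _ _⟩
  · ext s hs
    rw [hy, Measure.add_apply, Measure.sum_apply _ hs, Measure.sum_apply _ hs]
    rw [Summable.tsum_sum ENNReal.summable ENNReal.summable]
    simp

/-- The configuration `ω ∪ {x_i : i ∈ η}`, that is, the point measure `ω + ∑_{i ∈ η} ε_{x_i}`. -/
noncomputable def Configuration.addPoints {ι : Type*} (ω : Configuration X) (x : ι → X)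
    (η : Finset ι) : Configuration X :=
  ⟨ω.1 + ∑ i ∈ η, Measure.dirac (x i), by
    classical
    induction η using Finset.induction_on with
    | empty => simpa using ω.2
    | insert a s ha ih =>
      rw [Finset.sum_insert ha, add_comm (Measure.dirac (x a)), ← add_assoc]
      exact ih.add_dirac (x a)⟩

/-- The iterated finite difference `D_Θ F = D_{x_{i_1}} ⋯ D_{x_{i_l}} F`, `Θ = {i_1, …, i_l}`,
where `D_y F(ω) = F(ω ∪ {y}) - F(ω)`, in expanded form
`D_Θ F(ω) = ∑_{η ⊆ Θ} (-1)^{|Θ| - |η|} F(ω ∪ {x_i : i ∈ η})`. -/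
noncomputable def diff {ι : Type*} (x : ι → X) (Θ : Finset ι) (F : Configuration X → ℝ)
    (ω : Configuration X) : ℝ :=
  ∑ η ∈ Θ.powerset, (-1 : ℝ) ^ (Θ.card - η.card) * F (ω.addPoints x η)

theorem diff_empty {ι : Type*} (x : ι → X) (F : Configuration X → ℝ) (ω : Configuration X) :
    diff x ∅ F ω = F ω := by
  simp [diff, Configuration.addPoints]

/-- The expanded form is the composition of the one-point differences. -/
theorem diff_insert {ι : Type*} [DecidableEq ι] (x : ι → X) {a : ι} {Θ : Finset ι} (ha : a ∉ Θ)
    (F : Configuration X → ℝ) (ω : Configuration X) :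
    diff x (insert a Θ) F ω = diff x Θ F (ω.addPoints x {a}) - diff x Θ F ω := by
  unfold diff
  rw [Finset.sum_powerset_insert ha, add_comm, sub_eq_add_neg, ← Finset.sum_neg_distrib]
  congr 1
  · refine Finset.sum_congr rfl fun η hη => ?_
    have hη' := Finset.mem_powerset.1 hη
    have haη : a ∉ η := fun h => ha (hη' h)
    rw [Finset.card_insert_of_notMem ha, Finset.card_insert_of_notMem haη, Nat.add_sub_add_right]
    congr 2
    apply Subtype.ext
    simp [Configuration.addPoints, Finset.sum_insert haη, add_assoc]
  · refine Finset.sum_congr rfl fun η hη => ?_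
    have hle := Finset.card_le_card (Finset.mem_powerset.1 hη)
    rw [Finset.card_insert_of_notMem ha, Nat.succ_sub hle, pow_succ]
    ring

end

/-- `P` is the Poisson measure `π_σ` on the configuration space: under the probability measure `P`
the number of points in `B` is Poisson distributed with parameter `σ B`, and the numbers of points
in pairwise disjoint sets are mutually independent (for measurable sets of finite `σ`-measure). -/
structure IsPoissonMeasure {X : Type*} [TopologicalSpace X] [MeasurableSpace X]
    (σ : Measure X) (P : Measure (Configuration X)) : Prop where
  isProbabilityMeasure : IsProbabilityMeasure P
  map_eval : ∀ B : Set X, MeasurableSet B → σ B ≠ ∞ →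
    P.map (fun ω => ω.1 B) = (poissonMeasure (σ B).toNNReal).map (fun n : ℕ => (n : ℝ≥0∞))
  iIndepFun_eval : ∀ (p : ℕ) (B : Fin p → Set X), (∀ i, MeasurableSet (B i)) →
    (∀ i, σ (B i) ≠ ∞) → Pairwise (fun i j => Disjoint (B i) (B j)) →
    iIndepFun (fun (i : Fin p) (ω : Configuration X) => ω.1 (B i)) P

/-- The cyclic type condition `D_{Θ_1} τ(x_1, ω) ⋯ D_{Θ_m} τ(x_m, ω) = 0` for all `m ≥ 1`, all
points, all configurations and all covers of `{1, …, m}` by non-empty sets; since `τ` takes values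
in a general space, it is understood as
`D_{Θ_1} h_1(τ(x_1, ω)) ⋯ D_{Θ_m} h_m(τ(x_m, ω)) = 0` for all bounded Borel functions `h_i`. -/
def CyclicCondition {X Y : Type*} [TopologicalSpace X] [MeasurableSpace X] [MeasurableSpace Y]
    (τ : Configuration X → X → Y) : Prop :=
  ∀ (m : ℕ), 1 ≤ m → ∀ Θ : Fin m → Finset (Fin m), (∀ i, (Θ i).Nonempty) →
    (⋃ i, (Θ i : Set (Fin m))) = Set.univ →
    ∀ (x : Fin m → X) (ω : Configuration X) (h : Fin m → Y → ℝ),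
      (∀ i, Measurable (h i)) → (∀ i, ∃ C : ℝ, ∀ y, |h i y| ≤ C) →
      ∏ i, diff x (Θ i) (fun ω' => h i (τ ω' (x i))) ω = 0

open Classical in
/-- The induced map `τ_* ω = ∑_{x ∈ ω} ε_{τ(x, ω)} = ω ∘ τ(·, ω)⁻¹`, with the empty configuration
as default value where that image measure is not a Radon point measure. -/
noncomputable def pushConfig {X Y : Type*} [TopologicalSpace X] [MeasurableSpace X]
    [TopologicalSpace Y] [MeasurableSpace Y] (τ : Configuration X → X → Y)
    (ω : Configuration X) : Configuration Y :=
  if h : IsPointMeasure (ω.1.map (τ ω)) then ⟨ω.1.map (τ ω), h⟩ else ⟨0, isPointMeasure_zero⟩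

end PoissonTransform

/-! The counts of `τ_*ω` in disjoint sets of finite `μ`-measure are shown to have the joint
factorial moments of independent Poisson variables, and these moments determine the law.

Size-biasing and independence give the Mecke formula `IsPoissonMeasure.mecke`. Iterating it turns a
factorial moment of order `n` into the expectation over `ω` of the `σ^n`-measure of `{x | ∀ i, τ(ω +
∑_j ε_{x_j}, x_i) ∈ B_i}`. The crux, `CyclicCondition.measure_pi_transform`, is that this measure is
`∏ μ(B_i)` for every fixed `ω`.

Put `a_i(U) = 1_{B_i}(τ(ω + ∑_{j∈U} ε_{x_j}, x_i))`. Möbius inversion writes `a_i(U) - a_i(∅)` as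
the sum of the differences `D_Θ` over non-empty `Θ ⊆ U`. In `∑_U (-1)^{|U|} ∏_i (a_i(U) - a_i(∅))`
the families `Θ_i` that do not cover cancel in the sum over `U`, and the covering ones vanish by the
cyclic condition, so the sum is zero pointwise. Expanded, it is a signed sum of indicators whose
signs add up to zero. All these sets except the target have measure `∏ μ(B_i)` by induction on the
number of points, because some point either is moved by `ω` alone or is not added to the
configuration. Hence the target has this measure too.

The first moment gives almost sure finiteness on a countable base, hence local finiteness of `τ_*ω`.
The alternating factorial-moment series recovers the point probabilities, one coordinate at a time
(`map_eq_pi_poissonMeasure`). -/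

namespace PoissonTransform

/-! ### Configurations as an s-finite kernel -/

section Kernel

/-- A kernel all of whose measures are finite is s-finite. -/
theorem isSFiniteKernel_of_forall_isFiniteMeasure {α β : Type*} [MeasurableSpace α]
    [MeasurableSpace β] (κ : Kernel α β) (h : ∀ a, IsFiniteMeasure (κ a)) : IsSFiniteKernel κ := by
  classical
  set E : ℕ → Set α := fun k => {a | ⌊(κ a Set.univ).toReal⌋₊ = k} with hE
  have hm : ∀ k, MeasurableSet (E k) := fun k =>
    (Nat.measurable_floor.comp (κ.measurable_coe MeasurableSet.univ).ennreal_toReal)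
      (measurableSet_singleton k)
  have hsum : κ = Kernel.sum fun k => Kernel.piecewise (hm k) κ 0 := by
    ext a s hs
    rw [Kernel.sum_apply' _ _ hs, tsum_eq_single ⌊(κ a Set.univ).toReal⌋₊]
    · simp [Kernel.piecewise_apply, hE]
    · intro k hk
      have : a ∉ E k := fun h => hk h.symm
      simp [Kernel.piecewise_apply, this]
  rw [hsum]
  have : ∀ k, IsFiniteKernel (Kernel.piecewise (hm k) κ 0) := fun k =>
    ⟨⟨k + 1, by simp, fun a => by
      rw [Kernel.piecewise_apply]
      split_ifs with ha
      · have h1 := (Nat.lt_floor_add_one (κ a Set.univ).toReal).le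
        rw [show ⌊(κ a Set.univ).toReal⌋₊ = k from ha] at h1
        have := ENNReal.ofReal_le_ofReal h1
        rw [ENNReal.ofReal_toReal (measure_ne_top _ _)] at this
        refine this.trans_eq ?_
        rw [ENNReal.ofReal_add (by positivity) zero_le_one]
        simp
      · simp⟩⟩
  infer_instance

variable {X : Type*} [TopologicalSpace X] [MeasurableSpace X]

theorem measurable_eval {B : Set X} (hB : MeasurableSet B) :
    Measurable fun ω : Configuration X => ω.1 B :=
  (Measure.measurable_coe hB).comp measurable_subtype_coe

/-- The inclusion of the configuration space into the measures, as a kernel. -/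
noncomputable def configKernel (X : Type*) [TopologicalSpace X] [MeasurableSpace X] :
    Kernel (Configuration X) X :=
  ⟨fun ω => ω.1, measurable_subtype_coe⟩

@[simp] theorem configKernel_apply (ω : Configuration X) : configKernel X ω = ω.1 := rfl

-- One countable family serves all locally finite measures, so local finiteness can be tested by
-- countably many conditions. The empty set is adjoined so that the family can be enumerated by `ℕ`
-- even when `X` is empty.
variable (X) in
theorem exists_seq_isOpen_finite [SecondCountableTopology X] : ∃ U : ℕ → Set X, (∀ n, IsOpen (U n)) ∧
    ∀ ν : Measure X, IsLocallyFiniteMeasure ν → ∀ x, ∃ n, x ∈ U n ∧ ν (U n) < ∞ := by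
  obtain ⟨U, hU⟩ := ((TopologicalSpace.countable_countableBasis X).insert ∅).exists_eq_range
    (Set.insert_nonempty _ _)
  refine ⟨U, fun n => ?_, fun ν hν x => ?_⟩
  · have : U n ∈ insert ∅ (TopologicalSpace.countableBasis X) := hU ▸ Set.mem_range_self n
    rcases this with h | h
    · rw [h]; exact isOpen_empty
    · exact TopologicalSpace.isOpen_of_mem_countableBasis h
  · obtain ⟨s, hs, hlt⟩ := hν.finiteAtNhds x
    obtain ⟨t, ht, hxt, hts⟩ :=
      (TopologicalSpace.isBasis_countableBasis X).mem_nhds_iff.1 hs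
    have : t ∈ Set.range U := hU ▸ Set.mem_insert_of_mem _ ht
    obtain ⟨n, rfl⟩ := this
    exact ⟨n, hxt, (measure_mono hts).trans_lt hlt⟩

/-- Which basic open sets have finite mass depends on `ω`, so the partition of `X` into cells of
finite mass must depend on `ω` too. The cell `D n ω` is `U n` minus the earlier `U i` of finite
mass; it depends on `ω` only through finitely many yes/no answers, so each restriction of `ω` to a
cell is a measurable kernel with finite values. -/
instance [SecondCountableTopology X] [OpensMeasurableSpace X] :
    IsSFiniteKernel (configKernel X) := by
  classical
  obtain ⟨U, hUo, hU⟩ := exists_seq_isOpen_finite X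
  have hUm : ∀ n, MeasurableSet (U n) := fun n => (hUo n).measurableSet
  let T : ℕ → Configuration X → Finset ℕ := fun n ω =>
    (Finset.range n).filter fun i => ω.1 (U i) < ∞
  have hfin : ∀ n, MeasurableSet {ω : Configuration X | ω.1 (U n) < ∞} := fun n =>
    measurable_eval (hUm n) measurableSet_Iio
  have hT : ∀ n, Measurable (T n) := by
    intro n
    refine measurable_to_countable' fun t => ?_
    have : T n ⁻¹' {t} = ⋂ i, {ω | (i < n ∧ ω.1 (U i) < ∞) ↔ i ∈ t} := by
      ext ω
      simp [T, Finset.ext_iff]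
    rw [this]
    refine MeasurableSet.iInter fun i => ?_
    by_cases hin : i < n <;> by_cases hit : i ∈ t <;> simp only [hin, hit, true_and, false_and,
      iff_true, iff_false]
    · exact hfin i
    · exact (hfin i).compl
    · exact MeasurableSet.const _
    · exact MeasurableSet.const _
  let V : ℕ → Finset ℕ → Set X := fun n t => U n \ ⋃ i ∈ t, U i
  have hV : ∀ n t, MeasurableSet (V n t) := fun n t =>
    (hUm n).diff (t.measurableSet_biUnion fun i _ => hUm i)
  let D : ℕ → Configuration X → Set X := fun n ω => if ω.1 (U n) < ∞ then V n (T n ω) else ∅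
  have hD : ∀ n ω, MeasurableSet (D n ω) := fun n ω => by
    simp only [D]; split_ifs
    exacts [hV _ _, MeasurableSet.empty]
  have hDdisj : ∀ ω, Pairwise (Function.onFun Disjoint fun n => D n ω) := by
    intro ω
    rw [pairwise_disjoint_on]
    intro m n hmn
    rw [Set.disjoint_left]
    intro x hxm hxn
    simp only [D] at hxm hxn
    split_ifs at hxm hxn with h1 h2
    exacts [hxn.2 (Set.mem_biUnion (by simpa [T] using ⟨hmn, h1⟩) hxm.1), hxn, hxm, hxm]
  have hDunion : ∀ ω, ⋃ n, D n ω = Set.univ := by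
    intro ω
    rw [Set.eq_univ_iff_forall]
    intro x
    have hx := hU ω.1 ω.2.1 x
    rw [Set.mem_iUnion]
    refine ⟨Nat.find hx, ?_⟩
    have h1 := Nat.find_spec hx
    simp only [D, if_pos h1.2]
    refine ⟨h1.1, fun h => ?_⟩
    obtain ⟨i, hi, hxi⟩ := Set.mem_iUnion₂.1 h
    have hi' : i < Nat.find hx ∧ ω.1 (U i) < ∞ := by simpa [T] using hi
    exact Nat.find_min hx hi'.1 ⟨hxi, hi'.2⟩
  have hmeas : ∀ n, Measurable fun ω : Configuration X => ω.1.restrict (D n ω) := by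
    intro n
    refine Measure.measurable_of_measurable_coe _ fun B hB => ?_
    have : (fun ω : Configuration X => ω.1.restrict (D n ω) B) = fun ω =>
        {ω : Configuration X | ω.1 (U n) < ∞}.indicator
          (fun ω => (fun p : Finset ℕ × Configuration X => p.2.1 (B ∩ V n p.1)) (T n ω, ω)) ω := by
      ext ω
      rw [Measure.restrict_apply hB, Set.indicator_apply]
      by_cases h : ω.1 (U n) < ∞ <;> simp [D, h]
    rw [this]
    refine Measurable.indicator ?_ (hfin n)
    have hpair : Measurable fun p : Finset ℕ × Configuration X => p.2.1 (B ∩ V n p.1) :=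
      measurable_from_prod_countable_right fun t => measurable_eval (hB.inter (hV n t))
    exact hpair.comp ((hT n).prodMk measurable_id)
  let κ : ℕ → Kernel (Configuration X) X := fun n => ⟨_, hmeas n⟩
  have hκ : ∀ n ω, κ n ω = ω.1.restrict (D n ω) := fun _ _ => rfl
  have hsum : configKernel X = Kernel.sum κ := by
    ext1 ω
    rw [Kernel.sum_apply, configKernel_apply]
    simp_rw [hκ]
    rw [← Measure.restrict_iUnion (hDdisj ω) (hD · ω), hDunion, Measure.restrict_univ]
  have : ∀ n, IsSFiniteKernel (κ n) := fun n =>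
    isSFiniteKernel_of_forall_isFiniteMeasure _ fun ω => ⟨by
      rw [hκ, Measure.restrict_apply_univ]
      simp only [D]
      split_ifs with h
      · exact (measure_mono Set.sdiff_subset).trans_lt h
      · simp⟩
  rw [hsum]
  infer_instance

end Kernel

/-! ### Adding points to a configuration -/

section AddPoints

variable {X : Type*} [TopologicalSpace X] [MeasurableSpace X]

/-- The configuration `ω + ε_x`. -/
noncomputable def Configuration.add (ω : Configuration X) (x : X) : Configuration X :=
  ⟨ω.1 + Measure.dirac x, ω.2.add_dirac x⟩

theorem Configuration.add_apply (ω : Configuration X) (x : X) {B : Set X} (hB : MeasurableSet B) :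
    (ω.add x).1 B = ω.1 B + B.indicator 1 x := by
  simp [Configuration.add, Measure.dirac_apply' _ hB]

theorem measurable_configuration {α : Type*} [MeasurableSpace α] {f : α → Configuration X}
    (h : ∀ B, MeasurableSet B → Measurable fun a => (f a).1 B) : Measurable f :=
  (Measure.measurable_of_measurable_coe _ h).subtype_mk

theorem measurable_add : Measurable fun p : Configuration X × X => p.1.add p.2 := by
  refine measurable_configuration fun B hB => ?_
  simp_rw [Configuration.add_apply _ _ hB]
  exact ((measurable_eval hB).comp measurable_fst).add
    ((measurable_one.indicator hB).comp measurable_snd)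

theorem Configuration.addPoints_apply {ι : Type*} (ω : Configuration X) (x : ι → X) (η : Finset ι)
    {B : Set X} (hB : MeasurableSet B) :
    (ω.addPoints x η).1 B = ω.1 B + ∑ i ∈ η, B.indicator 1 (x i) := by
  simp [Configuration.addPoints, Measure.dirac_apply' _ hB]

theorem measurable_addPoints {ι : Type*} (η : Finset ι) :
    Measurable fun p : Configuration X × (ι → X) => p.1.addPoints p.2 η := by
  refine measurable_configuration fun B hB => ?_
  simp_rw [Configuration.addPoints_apply _ _ _ hB]
  refine ((measurable_eval hB).comp measurable_fst).add (Finset.measurable_sum _ fun i _ => ?_)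
  exact (measurable_one.indicator hB).comp ((measurable_pi_apply i).comp measurable_snd)

@[simp] theorem Configuration.addPoints_empty {ι : Type*} (ω : Configuration X) (x : ι → X) :
    ω.addPoints x ∅ = ω := by
  simp [addPoints]

end AddPoints

/-! ### The Mecke formula -/

/-- The size-biasing identity `E[Z φ(Z)] = r E[φ(Z + 1)]` of the Poisson law. -/
theorem lintegral_poisson_mul (r : ℝ≥0) {φ : ℝ≥0∞ → ℝ≥0∞} (hφ : Measurable φ) :
    ∫⁻ z, z * φ z ∂(poissonMeasure r).map (fun n : ℕ => (n : ℝ≥0∞)) =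
      r * ∫⁻ z, φ (z + 1) ∂(poissonMeasure r).map (fun n : ℕ => (n : ℝ≥0∞)) := by
  have hadd : Measurable fun z : ℝ≥0∞ => φ (z + 1) := hφ.comp (measurable_id.add_const 1)
  rw [lintegral_map (f := fun z => z * φ z) (measurable_id.mul hφ) .of_discrete, lintegral_map hadd .of_discrete,
    poissonMeasure]
  simp only [lintegral_sum_measure, lintegral_smul_measure, lintegral_dirac, smul_eq_mul]
  rw [tsum_eq_zero_add' ENNReal.summable, ← ENNReal.tsum_mul_left]
  simp only [Nat.cast_zero, zero_mul, mul_zero, zero_add]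
  refine tsum_congr fun n => ?_
  rw [Nat.cast_add, Nat.cast_one, ← mul_assoc, ← mul_assoc]
  congr 1
  rw [← ENNReal.ofReal_coe_nnreal (p := r), ← ENNReal.ofReal_mul (by positivity),
    show (n : ℝ≥0∞) + 1 = ENNReal.ofReal ((n : ℝ) + 1) by
      rw [ENNReal.ofReal_add (by positivity) zero_le_one]; simp,
    ← ENNReal.ofReal_mul (by positivity)]
  congr 1
  rw [Nat.factorial_succ]
  push_cast
  field_simp
  exact pow_succ' _ _

section Mecke

variable {X : Type*} [TopologicalSpace X] [MeasurableSpace X] {σ : Measure X}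
  {P : Measure (Configuration X)}

theorem IsPoissonMeasure.iIndepFun (hP : IsPoissonMeasure σ P) {J : Type*} [Finite J]
    {A : J → Set X} (hA : ∀ j, MeasurableSet (A j)) (hfin : ∀ j, σ (A j) ≠ ∞)
    (hd : Pairwise (fun i j => Disjoint (A i) (A j))) :
    ProbabilityTheory.iIndepFun (fun j (ω : Configuration X) => ω.1 (A j)) P := by
  obtain ⟨n, ⟨e⟩⟩ := Finite.exists_equiv_fin J
  have := hP.iIndepFun_eval n (fun i => A (e.symm i)) (fun i => hA _) (fun i => hfin _)
    fun i j hij => hd (e.symm.injective.ne hij)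
  have h2 := this.precomp e.injective
  simpa [Function.comp_def] using h2

theorem IsPoissonMeasure.lintegral_eval_mul (hP : IsPoissonMeasure σ P) {A : Set X}
    (hA : MeasurableSet A) (hfin : σ A ≠ ∞) {φ : ℝ≥0∞ → ℝ≥0∞} (hφ : Measurable φ) :
    ∫⁻ ω, ω.1 A * φ (ω.1 A) ∂P = σ A * ∫⁻ ω, φ (ω.1 A + 1) ∂P := by
  have hadd : Measurable fun z : ℝ≥0∞ => φ (z + 1) := hφ.comp (measurable_id.add_const 1)
  rw [← lintegral_map (f := fun z : ℝ≥0∞ => z * φ z) (measurable_id.mul hφ) (measurable_eval hA),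
    ← lintegral_map hadd (measurable_eval hA), hP.map_eval A hA hfin, lintegral_poisson_mul _ hφ,
    ENNReal.coe_toNNReal hfin]

/-- By independence both sides factorise when `E` is a rectangle, and they differ only in the factor
`k`, where size-biasing applies. Rectangles form a generating π-system. -/
theorem IsPoissonMeasure.mecke_disjoint (hP : IsPoissonMeasure σ P) {J : Type*} [Fintype J]
    [DecidableEq J] {A : J → Set X} (hA : ∀ j, MeasurableSet (A j)) (hfin : ∀ j, σ (A j) ≠ ∞)
    (hd : Pairwise (fun i j => Disjoint (A i) (A j))) (k : J) {E : Set (J → ℝ≥0∞)}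
    (hE : MeasurableSet E) :
    ∫⁻ ω, ω.1 (A k) * E.indicator 1 (fun j => ω.1 (A j)) ∂P =
      σ (A k) * ∫⁻ ω, E.indicator 1 (fun j => ω.1 (A j) + if j = k then 1 else 0) ∂P := by
  have := hP.isProbabilityMeasure
  have hmA : ∀ j, Measurable fun ω : Configuration X => ω.1 (A j) := fun j => measurable_eval (hA j)
  have hind := hP.iIndepFun hA hfin hd
  have hZ : Measurable fun (ω : Configuration X) j => ω.1 (A j) := measurable_pi_lambda _ hmA
  have hZ' : Measurable fun (ω : Configuration X) j => ω.1 (A j) + if j = k then 1 else 0 :=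
    measurable_pi_lambda _ fun j => (hmA j).add_const _
  have key : (P.withDensity fun ω => ω.1 (A k)).map (fun ω j => ω.1 (A j)) =
      σ (A k) • P.map (fun ω j => ω.1 (A j) + if j = k then 1 else 0) := by
    have hrect : ∀ s : J → Set ℝ≥0∞, (∀ j, MeasurableSet (s j)) →
        (P.withDensity fun ω => ω.1 (A k)).map (fun ω j => ω.1 (A j)) (Set.univ.pi s) =
        (σ (A k) • P.map (fun ω j => ω.1 (A j) + if j = k then 1 else 0)) (Set.univ.pi s) := by
      intro s hs
      have hpi := MeasurableSet.univ_pi hs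
      have hsm : ∀ j, Measurable ((s j).indicator (1 : ℝ≥0∞ → ℝ≥0∞)) := fun j =>
        measurable_one.indicator (hs j)
      have hprod : ∀ z : J → ℝ≥0∞, (Set.univ.pi s).indicator (1 : (J → ℝ≥0∞) → ℝ≥0∞) z =
          ∏ j, (s j).indicator 1 (z j) := by
        intro z
        by_cases hz : z ∈ Set.univ.pi s
        · rw [Set.indicator_of_mem hz, Finset.prod_eq_one fun j _ =>
            Set.indicator_of_mem (hz j trivial) _]
          rfl
        · rw [Set.indicator_of_notMem hz]
          simp only [Set.mem_univ_pi, not_forall] at hz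
          obtain ⟨j, hj⟩ := hz
          rw [Finset.prod_eq_zero (Finset.mem_univ j) (Set.indicator_of_notMem hj _)]
      rw [Measure.smul_apply, Measure.map_apply hZ hpi, Measure.map_apply hZ' hpi,
        withDensity_apply _ (hZ hpi), ← lintegral_indicator_one (hZ' hpi), smul_eq_mul,
        ← lintegral_indicator (hZ hpi)]
      have e1 : ∀ ω : Configuration X, ((fun (ω : Configuration X) j => ω.1 (A j)) ⁻¹'
          Set.univ.pi s).indicator (fun ω => ω.1 (A k)) ω =
          ∏ j, (if j = k then ω.1 (A j) else 1) * (s j).indicator 1 (ω.1 (A j)) := by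
        intro ω
        rw [Finset.prod_mul_distrib, Finset.prod_ite_eq' Finset.univ k, if_pos (Finset.mem_univ k),
          ← hprod fun j => ω.1 (A j)]
        by_cases h : (fun j => ω.1 (A j)) ∈ Set.univ.pi s
        · rw [Set.indicator_of_mem h, Set.indicator_of_mem (show ω ∈
            (fun (ω : Configuration X) j => ω.1 (A j)) ⁻¹' Set.univ.pi s from h)]
          simp
        · rw [Set.indicator_of_notMem h, Set.indicator_of_notMem (show ω ∉
            (fun (ω : Configuration X) j => ω.1 (A j)) ⁻¹' Set.univ.pi s from h)]
          simp
      have e2 : ∀ ω : Configuration X, ((fun (ω : Configuration X) j =>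
          ω.1 (A j) + if j = k then 1 else 0) ⁻¹' Set.univ.pi s).indicator
            (1 : Configuration X → ℝ≥0∞) ω =
          ∏ j, (s j).indicator 1 (ω.1 (A j) + if j = k then 1 else 0) := by
        intro ω
        rw [← hprod fun j => ω.1 (A j) + if j = k then 1 else 0]
        rfl
      rw [lintegral_congr e1, lintegral_congr e2]
      have i1 := hind.comp (fun j z => (if j = k then z else 1) * (s j).indicator 1 z) fun j => by
        refine Measurable.mul ?_ (hsm j)
        split_ifs
        exacts [measurable_id, measurable_const]
      have i2 := hind.comp (fun j z => (s j).indicator 1 (z + if j = k then 1 else 0)) fun j =>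
        (hsm j).comp (measurable_id.add_const _)
      rw [lintegral_prod_eq_prod_lintegral_of_indepFun Finset.univ
          (fun j (ω : Configuration X) => (if j = k then ω.1 (A j) else 1) *
            (s j).indicator 1 (ω.1 (A j))) i1 fun j => by
          refine Measurable.mul ?_ ((hsm j).comp (hmA j))
          split_ifs
          exacts [hmA j, measurable_const],
        lintegral_prod_eq_prod_lintegral_of_indepFun Finset.univ
          (fun j (ω : Configuration X) => (s j).indicator 1 (ω.1 (A j) + if j = k then 1 else 0))
          i2 fun j => (hsm j).comp ((hmA j).add_const _),
        ← Finset.mul_prod_erase _ _ (Finset.mem_univ k),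
        ← Finset.mul_prod_erase _ _ (Finset.mem_univ k), ← mul_assoc]
      congr 1
      · simp only [if_true]
        exact hP.lintegral_eval_mul (hA k) (hfin k) (hsm k)
      · refine Finset.prod_congr rfl fun j hj => ?_
        simp [Finset.ne_of_mem_erase hj]
    -- The rectangle identity with all sides `univ` gives total mass `σ (A k)`.
    have hfinite : IsFiniteMeasure
        ((P.withDensity fun ω => ω.1 (A k)).map (fun ω j => ω.1 (A j))) := by
      refine ⟨?_⟩
      have := hrect (fun _ => Set.univ) fun _ => MeasurableSet.univ
      rw [Set.pi_univ] at this
      rw [this, Measure.smul_apply, Measure.map_apply hZ' MeasurableSet.univ]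
      simpa using (hfin k).lt_top
    refine ext_of_generate_finite _ generateFrom_pi.symm isPiSystem_pi ?_ ?_
    · rintro _ ⟨s, hs, rfl⟩
      exact hrect s fun j => hs j trivial
    · simpa [Set.pi_univ] using hrect (fun _ => Set.univ) fun _ => MeasurableSet.univ
  have h1 := congrArg (fun m : Measure (J → ℝ≥0∞) => m E) key
  simp only [Measure.smul_apply, smul_eq_mul] at h1
  rw [Measure.map_apply hZ hE, Measure.map_apply hZ' hE, withDensity_apply _ (hZ hE),
    ← lintegral_indicator_one (hZ' hE), ← lintegral_indicator (hZ hE)] at h1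
  refine Eq.trans (lintegral_congr fun ω => ?_) h1
  by_cases h : (fun j => ω.1 (A j)) ∈ E <;> simp [h]

/-- Overlapping sets are cut into the atoms of the algebra they generate: `T x` records which `B i`
contain `x`. The counts of the `B i` are the sums `L` of atom counts, and the disjoint case is
summed over the atoms inside `B k`. The atom of the empty label is left out, since it may have
infinite `σ`-measure. -/
theorem IsPoissonMeasure.mecke_cylinder (hP : IsPoissonMeasure σ P) {ι : Type*} [Fintype ι]
    {B : ι → Set X} (hB : ∀ i, MeasurableSet (B i)) (hfin : ∀ i, σ (B i) ≠ ∞) (k : ι)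
    {E : Set (ι → ℝ≥0∞)} (hE : MeasurableSet E) :
    ∫⁻ ω, ω.1 (B k) * E.indicator 1 (fun i => ω.1 (B i)) ∂P =
      ∫⁻ x in B k, ∫⁻ ω, E.indicator 1 (fun i => (ω.add x).1 (B i)) ∂P ∂σ := by
  classical
  let T : X → Finset ι := fun x => Finset.univ.filter fun i => x ∈ B i
  have hT : ∀ S, MeasurableSet (T ⁻¹' {S}) := by
    intro S
    have : T ⁻¹' {S} = ⋂ i, {x | x ∈ B i ↔ i ∈ S} := by
      ext x; simp [T, Finset.ext_iff]
    rw [this]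
    refine MeasurableSet.iInter fun i => ?_
    by_cases hi : i ∈ S <;> simp only [hi, iff_true, iff_false]
    exacts [hB i, (hB i).compl]
  let J := {S : Finset ι // S.Nonempty}
  let A : J → Set X := fun S => T ⁻¹' {S.1}
  have hA : ∀ S, MeasurableSet (A S) := fun S => hT _
  have hsub : ∀ (S : J) i, i ∈ S.1 → A S ⊆ B i := by
    rintro S i hi x hx
    rw [← show T x = S.1 from hx] at hi
    simpa [T] using hi
  have hAfin : ∀ S, σ (A S) ≠ ∞ := by
    intro S
    obtain ⟨i, hi⟩ := S.2
    exact ((measure_mono (hsub S i hi)).trans_lt (hfin i).lt_top).ne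
  have hAd : Pairwise fun S S' => Disjoint (A S) (A S') := by
    intro S S' h
    rw [Set.disjoint_left]
    intro x hx hx'
    exact h (Subtype.ext ((show T x = S.1 from hx).symm.trans hx'))
  have hBA : ∀ i, B i = ⋃ S ∈ (Finset.univ.filter fun S : J => i ∈ S.1), A S := by
    intro i
    ext x
    simp only [Finset.mem_filter, Finset.mem_univ, true_and, Set.mem_iUnion]
    refine ⟨fun hx => ?_, fun ⟨S, hi, hx⟩ => hsub S i hi hx⟩
    have hi : i ∈ T x := by simpa [T] using hx
    exact ⟨⟨T x, ⟨i, hi⟩⟩, hi, rfl⟩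
  have hsum : ∀ (ν : Measure X) i, ν (B i) = ∑ S : J with i ∈ S.1, ν (A S) := by
    intro ν i
    rw [hBA i, measure_biUnion_finset (fun S _ S' _ h => hAd h) fun S _ => hA S]
  let L : (J → ℝ≥0∞) → ι → ℝ≥0∞ := fun z i => ∑ S : J with i ∈ S.1, z S
  have hL : Measurable L := measurable_pi_lambda _ fun i =>
    Finset.measurable_sum _ fun S _ => measurable_pi_apply S
  have hLω : ∀ ω : Configuration X, (fun i => ω.1 (B i)) = L fun S => ω.1 (A S) := fun ω =>
    funext fun i => hsum ω.1 i
  have hLadd : ∀ (ω : Configuration X) (S : J) (x : X), x ∈ A S →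
      (fun i => (ω.add x).1 (B i)) = L fun S' => ω.1 (A S') + if S' = S then 1 else 0 := by
    intro ω S x hx
    rw [hLω]
    congr 1
    ext S'
    rw [Configuration.add_apply _ _ (hA S')]
    congr 1
    by_cases h : S' = S
    · rw [h, Set.indicator_of_mem hx, if_pos rfl]; rfl
    · rw [Set.indicator_of_notMem (fun hx' => Set.disjoint_left.1 (hAd h) hx' hx), if_neg h]
  have h1 : ∀ ω : Configuration X, ω.1 (B k) * E.indicator 1 (fun i => ω.1 (B i)) =
      ∑ S : J with k ∈ S.1, ω.1 (A S) * (L ⁻¹' E).indicator 1 (fun S => ω.1 (A S)) := by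
    intro ω
    rw [hLω ω, hsum ω.1 k, Finset.sum_mul]
    rfl
  have hZ : Measurable fun (ω : Configuration X) S => ω.1 (A S) :=
    measurable_pi_lambda _ fun S => measurable_eval (hA S)
  rw [lintegral_congr h1, lintegral_finsetSum (f := fun S (ω : Configuration X) =>
      ω.1 (A S) * (L ⁻¹' E).indicator 1 (fun S => ω.1 (A S))) _ fun S _ =>
    (measurable_eval (hA S)).mul ((measurable_one.indicator (hL hE)).comp hZ)]
  conv_rhs => rw [hBA k]
  rw [lintegral_biUnion_finset (fun S _ S' _ h => hAd h) fun S _ => hA S]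
  refine Finset.sum_congr rfl fun S _ => ?_
  rw [hP.mecke_disjoint hA hAfin hAd S (hL hE)]
  rw [setLIntegral_congr_fun (hA S) (g := fun _ => ∫⁻ ω, (L ⁻¹' E).indicator 1
      (fun S' => ω.1 (A S') + if S' = S then 1 else 0) ∂P) fun x hx => by
    simp only [hLadd _ S x hx]; rfl]
  rw [setLIntegral_const, mul_comm]

-- The Poisson axioms see only sets of finite `σ`-measure; these suffice because `ω B` is the
-- supremum of `ω (B ∩ spanningSets σ n)`. The `piiUnionInter` form exhibits a π-system of
-- cylinders.
variable (σ) in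
theorem generateFrom_cylinders [SigmaFinite σ] :
    (Subtype.instMeasurableSpace : MeasurableSpace (Configuration X)) =
      MeasurableSpace.generateFrom (piiUnionInter
        (fun B : {B : Set X // MeasurableSet B ∧ σ B ≠ ∞} =>
          {E | MeasurableSet[MeasurableSpace.comap (fun ω : Configuration X => ω.1 B.1)
            inferInstance] E}) Set.univ) := by
  rw [generateFrom_piiUnionInter_measurableSet (fun B : {B : Set X // MeasurableSet B ∧ σ B ≠ ∞} =>
    MeasurableSpace.comap (fun ω : Configuration X => ω.1 B.1) inferInstance)]
  refine le_antisymm ?_ (iSup₂_le fun B _ => ?_)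
  · set m' : MeasurableSpace (Configuration X) :=
      ⨆ B ∈ (Set.univ : Set {B : Set X // MeasurableSet B ∧ σ B ≠ ∞}),
      MeasurableSpace.comap (fun ω : Configuration X => ω.1 B.1) inferInstance with hm'
    have h0 : ∀ B : Set X, MeasurableSet B → σ B ≠ ∞ →
        Measurable[m'] fun ω : Configuration X => ω.1 B := by
      intro B hB hfin
      refine Measurable.mono (comap_measurable _) ?_ le_rfl
      exact le_iSup₂ (f := fun (B : {B : Set X // MeasurableSet B ∧ σ B ≠ ∞})
        (_ : B ∈ (Set.univ : Set _)) =>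
        MeasurableSpace.comap (fun ω : Configuration X => ω.1 B.1) inferInstance) ⟨B, hB, hfin⟩
        trivial
    have : @Measurable _ _ m' Subtype.instMeasurableSpace (id : Configuration X → Configuration X) := by
      refine @measurable_configuration X _ _ _ m' _ fun B hB => ?_
      have hsup : (fun ω : Configuration X => (id ω).1 B) =
          fun ω => ⨆ n, ω.1 (B ∩ spanningSets σ n) := by
        ext ω
        rw [← (monotone_const.inter (monotone_spanningSets σ)).measure_iUnion (μ := ω.1),
          ← Set.inter_iUnion, iUnion_spanningSets, Set.inter_univ]
        rfl
      rw [hsup]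
      refine @Measurable.iSup _ _ _ _ _ m' _ _ _ _ _ _ fun n => ?_
      exact h0 _ (hB.inter (measurableSet_spanningSets σ n))
        ((measure_mono Set.inter_subset_right).trans_lt (measure_spanningSets_lt_top σ n)).ne
    intro s hs
    exact this hs
  · exact (measurable_eval B.2.1).comap_le

/-- Two finite measures that agree on the π-system of cylinders are equal. The cylinder identity is
used with the index `none` for the weight set `B` and `some i` for the sets that define the
cylinder. -/
theorem IsPoissonMeasure.mecke_set (hP : IsPoissonMeasure σ P) [SigmaFinite σ] {B : Set X}
    (hB : MeasurableSet B) (hfin : σ B ≠ ∞) :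
    P.withDensity (fun ω => ω.1 B) =
      (P.prod (σ.restrict B)).map fun p => p.1.add p.2 := by
  have := hP.isProbabilityMeasure
  have hcyl : ∀ (t : Finset {B : Set X // MeasurableSet B ∧ σ B ≠ ∞})
      (V : {B : Set X // MeasurableSet B ∧ σ B ≠ ∞} → Set ℝ≥0∞), (∀ i, MeasurableSet (V i)) →
      P.withDensity (fun ω => ω.1 B) (⋂ i ∈ t, {ω | ω.1 i.1 ∈ V i}) =
      (P.prod (σ.restrict B)).map (fun p => p.1.add p.2) (⋂ i ∈ t, {ω | ω.1 i.1 ∈ V i}) := by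
    classical
    intro t V hV
    let D : Option t → Set X := fun o => o.elim B fun i => i.1.1
    let E : Set (Option t → ℝ≥0∞) := ⋂ i : t, {z | z (some i) ∈ V i}
    have hE : MeasurableSet E := MeasurableSet.iInter fun i => (measurable_pi_apply _) (hV i)
    have key := hP.mecke_cylinder (B := D) (by rintro (_ | i); exacts [hB, i.1.2.1])
      (by rintro (_ | i); exacts [hfin, i.1.2.2]) none hE
    have hs : MeasurableSet (⋂ i ∈ t, {ω : Configuration X | ω.1 i.1 ∈ V i}) :=
      t.measurableSet_biInter fun i _ => measurable_eval i.2.1 (hV i)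
    have hmem : ∀ ω : Configuration X, E.indicator (1 : (Option t → ℝ≥0∞) → ℝ≥0∞) (fun i => ω.1 (D i)) =
        (⋂ i ∈ t, {ω : Configuration X | ω.1 i.1 ∈ V i}).indicator 1 ω := by
      intro ω
      have : (fun i => ω.1 (D i)) ∈ E ↔ ω ∈ ⋂ i ∈ t, {ω : Configuration X | ω.1 i.1 ∈ V i} := by
        simp [E, D]
      by_cases h : ω ∈ ⋂ i ∈ t, {ω : Configuration X | ω.1 i.1 ∈ V i}
      · rw [Set.indicator_of_mem h, Set.indicator_of_mem (this.2 h)]; rfl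
      · rw [Set.indicator_of_notMem h, Set.indicator_of_notMem (fun h' => h (this.1 h'))]
    simp only [hmem] at key
    rw [withDensity_apply _ hs, ← lintegral_indicator hs, ← lintegral_indicator_one hs,
      lintegral_map (measurable_one.indicator hs) measurable_add,
      lintegral_prod_symm (fun p : Configuration X × X => (⋂ i ∈ t,
        {ω : Configuration X | ω.1 i.1 ∈ V i}).indicator 1 (p.1.add p.2)) ((measurable_one.indicator hs).comp measurable_add).aemeasurable]
    refine Eq.trans (lintegral_congr fun ω => ?_) key
    by_cases h : ω ∈ ⋂ i ∈ t, {ω : Configuration X | ω.1 i.1 ∈ V i} <;>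
      simp [h, D]
  have huniv := hcyl ∅ (fun _ => Set.univ) fun _ => MeasurableSet.univ
  simp only [Finset.notMem_empty, Set.iInter_of_empty, Set.iInter_univ] at huniv
  have : IsFiniteMeasure (P.withDensity fun ω => ω.1 B) := by
    refine ⟨?_⟩
    rw [huniv, Measure.map_apply measurable_add MeasurableSet.univ, Set.preimage_univ,
      ← Set.univ_prod_univ, Measure.prod_prod]
    simpa using hfin.lt_top
  refine ext_of_generate_finite _ (generateFrom_cylinders σ)
    (isPiSystem_piiUnionInter _ (fun B => @MeasurableSpace.isPiSystem_measurableSet _ (_)) _) ?_ huniv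
  rintro s ⟨t, -, f, hf, rfl⟩
  choose! V hV using hf
  have := hcyl t (fun i => if h : i ∈ t then V i else Set.univ) fun i => by
    split_ifs with h
    exacts [(hV i h).1, MeasurableSet.univ]
  have hset : (⋂ i ∈ t, {ω : Configuration X | ω.1 i.1 ∈ if h : i ∈ t then V i else Set.univ}) =
      ⋂ i ∈ t, f i := by
    refine Set.iInter₂_congr fun i hi => ?_
    rw [← (hV i hi).2]
    simp only [dif_pos hi]
    rfl
  rwa [hset] at this

/-- The Mecke formula: the Campbell measure of the Poisson process. -/
theorem IsPoissonMeasure.mecke_measure [SecondCountableTopology X] [OpensMeasurableSpace X]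
    (hP : IsPoissonMeasure σ P) [SigmaFinite σ] :
    P.compProd (configKernel X) = (P.prod σ).map fun p => (p.1.add p.2, p.2) := by
  have := hP.isProbabilityMeasure
  have hf : Measurable fun p : Configuration X × X => (p.1.add p.2, p.2) :=
    measurable_add.prodMk measurable_snd
  have hrect : ∀ {E : Set (Configuration X)} {B : Set X}, MeasurableSet E → MeasurableSet B →
      σ B ≠ ∞ → P.compProd (configKernel X) (E ×ˢ B) =
        (P.prod σ).map (fun p => (p.1.add p.2, p.2)) (E ×ˢ B) := by
    intro E B hE hB hfin
    have h1 := congrArg (fun m : Measure (Configuration X) => m E) (hP.mecke_set hB hfin)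
    beta_reduce at h1
    rw [Measure.compProd_apply_prod hE hB, Measure.map_apply hf (hE.prod hB)]
    rw [withDensity_apply _ hE, Measure.map_apply measurable_add hE] at h1
    refine h1.trans ?_
    rw [← Measure.restrict_univ (μ := P), Measure.prod_restrict, Measure.restrict_univ,
      Measure.restrict_apply (measurable_add hE)]
    congr 1
    ext p
    simp
  -- Both measures may be infinite, so they are compared on strips over sets of finite `σ`-measure.
  have hcov : ⋃ n, (Set.univ : Set (Configuration X)) ×ˢ spanningSets σ n = Set.univ := by
    rw [← Set.prod_iUnion, iUnion_spanningSets, Set.univ_prod_univ]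
  refine (Measure.ext_iff_of_iUnion_eq_univ hcov).2 fun n => ?_
  have hSn := measurableSet_spanningSets σ n
  have hfin : IsFiniteMeasure
      ((P.compProd (configKernel X)).restrict (Set.univ ×ˢ spanningSets σ n)) := by
    refine ⟨?_⟩
    rw [Measure.restrict_apply_univ, hrect MeasurableSet.univ hSn
      (measure_spanningSets_lt_top σ n).ne, Measure.map_apply hf (MeasurableSet.univ.prod hSn)]
    have : (fun p : Configuration X × X => (p.1.add p.2, p.2)) ⁻¹'
        (Set.univ ×ˢ spanningSets σ n) = Set.univ ×ˢ spanningSets σ n := by ext; simp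
    rw [this, Measure.prod_prod]
    simpa using measure_spanningSets_lt_top σ n
  refine Measure.ext_prod fun {E B} hE hB => ?_
  rw [Measure.restrict_apply (hE.prod hB), Measure.restrict_apply (hE.prod hB),
    Set.prod_inter_prod, Set.inter_univ]
  exact hrect hE (hB.inter hSn)
    ((measure_mono Set.inter_subset_right).trans_lt (measure_spanningSets_lt_top σ n)).ne

/-- The Mecke formula `E ∫ u(ω, x) ω(dx) = E ∫ u(ω + ε_x, x) σ(dx)`. -/
theorem IsPoissonMeasure.mecke [SecondCountableTopology X] [OpensMeasurableSpace X]
    (hP : IsPoissonMeasure σ P) [SigmaFinite σ] {u : Configuration X × X → ℝ≥0∞}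
    (hu : Measurable u) :
    ∫⁻ ω, ∫⁻ x, u (ω, x) ∂ω.1 ∂P = ∫⁻ ω, ∫⁻ x, u (ω.add x, x) ∂σ ∂P := by
  have := hP.isProbabilityMeasure
  have hf : Measurable fun p : Configuration X × X => (p.1.add p.2, p.2) :=
    measurable_add.prodMk measurable_snd
  have h := Measure.lintegral_compProd (μ := P) (κ := configKernel X) hu
  simp only [configKernel_apply] at h
  rw [← h, hP.mecke_measure, lintegral_map hu hf, lintegral_prod (fun p : Configuration X × X => u (p.1.add p.2, p.2)) (hu.comp hf).aemeasurable]

end Mecke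

/-! ### Factorial moments of counts in random sets -/

/-- The falling factorial `N (N - 1) ⋯ (N - n + 1)` of an extended nonnegative real number. -/
noncomputable def fallingFactorial (n : ℕ) (N : ℝ≥0∞) : ℝ≥0∞ := ∏ j ∈ Finset.range n, (N - j)

@[simp] theorem fallingFactorial_zero (N : ℝ≥0∞) : fallingFactorial 0 N = 1 := by
  simp [fallingFactorial]

theorem fallingFactorial_succ (n : ℕ) (N : ℝ≥0∞) :
    fallingFactorial (n + 1) N = N * fallingFactorial n (N - 1) := by
  rw [fallingFactorial, Finset.prod_range_succ', mul_comm]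
  simp only [fallingFactorial, Nat.cast_zero, tsub_zero, Nat.cast_add, Nat.cast_one]
  congr 1
  refine Finset.prod_congr rfl fun j _ => ?_
  rw [add_comm, tsub_add_eq_tsub_tsub]

theorem fallingFactorial_natCast (n N : ℕ) :
    fallingFactorial n (N : ℝ≥0∞) = (N.descFactorial n : ℕ) := by
  rw [fallingFactorial, Nat.descFactorial_eq_prod_range]
  push_cast
  rfl

theorem measurable_fallingFactorial (n : ℕ) : Measurable (fallingFactorial n) :=
  Finset.measurable_prod _ fun _ _ => measurable_id.sub_const _

/-- This isolates one application of the Mecke formula: `N k` becomes the integral over a chosen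
point, and the `- 1` will be cancelled by the point that the formula adds. -/
theorem prod_fallingFactorial_succ {K : Type*} [Fintype K] [DecidableEq K] (m : K → ℕ)
    (N : K → ℝ≥0∞) (k : K) :
    ∏ j, fallingFactorial ((if k = j then 1 else 0) + m j) (N j) =
      N k * ∏ j, fallingFactorial (m j) (N j - if k = j then 1 else 0) := by
  rw [← Finset.mul_prod_erase _ _ (Finset.mem_univ k),
    ← Finset.mul_prod_erase _ _ (Finset.mem_univ k), if_pos rfl, if_pos rfl, add_comm 1,
    fallingFactorial_succ, ← mul_assoc]
  congr 1
  refine Finset.prod_congr rfl fun j hj => ?_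
  simp [(Finset.ne_of_mem_erase hj).symm]

section Moments

variable {X : Type*} [TopologicalSpace X] [MeasurableSpace X] {σ : Measure X}
  {P : Measure (Configuration X)}

theorem Configuration.addPoints_add {n : ℕ} (ω : Configuration X) (y : X) (x : Fin n → X) :
    (ω.addPoints x Finset.univ).add y =
      ω.addPoints (Fin.cons y x : Fin (n + 1) → X) Finset.univ := by
  apply Subtype.ext
  simp only [addPoints, add, Fin.sum_univ_succ, Fin.cons_zero, Fin.cons_succ]
  abel

theorem measurable_section_count [SecondCountableTopology X] [OpensMeasurableSpace X]
    {A : Set (Configuration X × X)} (hA : MeasurableSet A) :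
    Measurable fun ω : Configuration X => ω.1 {y | (ω, y) ∈ A} :=
  Kernel.measurable_kernel_prodMk_left (κ := configKernel X) hA

/-- Joint factorial moments of the numbers of points of a Poisson process in disjoint random
sets. -/
theorem IsPoissonMeasure.lintegral_prod_fallingFactorial [SecondCountableTopology X]
    [OpensMeasurableSpace X] (hP : IsPoissonMeasure σ P) [SigmaFinite σ] {K : Type*} [Fintype K]
    [DecidableEq K] {n : ℕ} (c : Fin n → K) {A : K → Set (Configuration X × X)}
    (hA : ∀ k, MeasurableSet (A k)) (hd : Pairwise fun i j => Disjoint (A i) (A j))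
    {W : Configuration X → ℝ≥0∞} (hW : Measurable W) :
    ∫⁻ ω, W ω * ∏ k, fallingFactorial (Finset.univ.filter fun i => c i = k).card
        (ω.1 {y | (ω, y) ∈ A k}) ∂P =
      ∫⁻ x : Fin n → X, ∫⁻ ω, W (ω.addPoints x Finset.univ) *
        ∏ i, (A (c i)).indicator 1 (ω.addPoints x Finset.univ, x i) ∂P
        ∂Measure.pi fun _ => σ := by
  have := hP.isProbabilityMeasure
  induction n generalizing A W with
  | zero =>
    rw [Measure.pi_of_empty (fun _ => σ) default, lintegral_dirac]
    simp
  | succ n ih =>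
    set k := c 0
    set c' : Fin n → K := fun i => c i.succ
    set m : K → ℕ := fun j => (Finset.univ.filter fun i => c' i = j).card
    have hm : ∀ j, (Finset.univ.filter fun i => c i = j).card =
        (if k = j then 1 else 0) + m j := by
      intro j
      rw [Fin.card_filter_univ_succ]
      split_ifs
      · simp only [m, c']; ring
      · simp only [m, c']; ring
    set R : Configuration X → ℝ≥0∞ := fun ω => W ω * ∏ j, fallingFactorial (m j)
      (ω.1 {y | (ω, y) ∈ A j} - if k = j then 1 else 0) with hR
    have hRm : Measurable R := hW.mul (Finset.measurable_prod _ fun j _ =>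
      (measurable_fallingFactorial _).comp ((measurable_section_count (hA j)).sub_const _))
    have hind : Measurable ((A k).indicator (1 : Configuration X × X → ℝ≥0∞)) :=
      measurable_one.indicator (hA k)
    have e1 : ∀ ω : Configuration X, W ω * ∏ j, fallingFactorial
        (Finset.univ.filter fun i => c i = j).card (ω.1 {y | (ω, y) ∈ A j}) =
        ∫⁻ x, (A k).indicator 1 (ω, x) * R ω ∂ω.1 := by
      intro ω
      simp_rw [hm]
      rw [prod_fallingFactorial_succ m (fun j => ω.1 {y | (ω, y) ∈ A j}) k,
        lintegral_mul_const (f := fun x => (A k).indicator 1 (ω, x)) _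
          (hind.comp measurable_prodMk_left)]
      have : ∫⁻ x, (A k).indicator 1 (ω, x) ∂ω.1 = ω.1 {y | (ω, y) ∈ A k} := by
        exact lintegral_indicator_one (measurable_prodMk_left (x := ω) (hA k))
      rw [this, hR]
      ring
    rw [lintegral_congr e1, hP.mecke (u := fun p => (A k).indicator 1 p * R p.1)
      (hind.mul (hRm.comp measurable_fst))]
    have hadd : Measurable fun p : Configuration X × X => (p.1.add p.2, p.2) :=
      measurable_add.prodMk measurable_snd
    rw [lintegral_lintegral_swap (f := fun (ω : Configuration X) x =>
      (A k).indicator 1 (ω.add x, x) * R (ω.add x))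
      ((hind.comp hadd).mul (hRm.comp measurable_add)).aemeasurable]
    have e2 : ∀ x : X, ∫⁻ ω : Configuration X, (A k).indicator 1 (ω.add x, x) * R (ω.add x) ∂P =
        ∫⁻ x' : Fin n → X, ∫⁻ ω, W (ω.addPoints (Fin.cons x x' : Fin (n + 1) → X) Finset.univ) *
          ∏ i, (A (c i)).indicator 1 (ω.addPoints (Fin.cons x x' : Fin (n + 1) → X) Finset.univ,
            (Fin.cons x x' : Fin (n + 1) → X) i) ∂P ∂Measure.pi fun _ => σ := by
      intro x
      have haddx : Measurable fun ω : Configuration X => ω.add x :=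
        measurable_add.comp measurable_prodMk_right
      have hpx : Measurable fun p : Configuration X × X => (p.1.add x, p.2) :=
        (haddx.comp measurable_fst).prodMk measurable_snd
      -- The chosen point `x` is absorbed into the random sets and the weight; this is why both are
      -- allowed to depend on `ω`.
      have h := ih c' (A := fun j => (fun p : Configuration X × X => (p.1.add x, p.2)) ⁻¹' A j)
        (fun j => hpx (hA j)) (fun i j hij => (hd hij).preimage _)
        (W := fun ω => (A k).indicator 1 (ω.add x, x) * W (ω.add x))
        ((hind.comp (haddx.prodMk measurable_const)).mul (hW.comp haddx))
      refine Eq.trans (lintegral_congr fun ω => ?_) (h.trans ?_)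
      · by_cases hx : (ω.add x, x) ∈ A k
        · rw [hR, mul_assoc, Set.indicator_of_mem hx]
          refine congrArg (1 * ·) (congrArg (W (ω.add x) * ·) ?_)
          refine Finset.prod_congr rfl fun j _ => ?_
          congr 1
          have hs : MeasurableSet {y | (ω.add x, y) ∈ A j} := measurable_prodMk_left (hA j)
          rw [Configuration.add_apply _ _ hs]
          -- Since `x` lies in the section of `A k`, it raises that count by one; by disjointness it
          -- leaves the others unchanged.
          by_cases hj : k = j
          · subst hj
            rw [Set.indicator_of_mem (show x ∈ {y | (ω.add x, y) ∈ A k} from hx), if_pos rfl]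
            exact ENNReal.add_sub_cancel_right ENNReal.one_ne_top
          · rw [Set.indicator_of_notMem (show x ∉ {y | (ω.add x, y) ∈ A j} from
              fun h => Set.disjoint_left.1 (hd hj) hx h), if_neg hj, add_zero, tsub_zero]
            rfl
        · rw [Set.indicator_of_notMem hx, zero_mul, zero_mul, zero_mul]
      · refine lintegral_congr fun x' => lintegral_congr fun ω => ?_
        rw [Fin.prod_univ_succ]
        simp only [Configuration.addPoints_add, Fin.cons_zero, Fin.cons_succ]
        have : ∀ (j : K) (p : Configuration X × X),
            ((fun p : Configuration X × X => (p.1.add x, p.2)) ⁻¹' A j).indicator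
              (1 : Configuration X × X → ℝ≥0∞) p = (A j).indicator 1 (p.1.add x, p.2) :=
          fun _ _ => rfl
        simp only [this, Configuration.addPoints_add]
        ring
    rw [lintegral_congr e2]
    set G : (Fin (n + 1) → X) → ℝ≥0∞ := fun x => ∫⁻ ω, W (ω.addPoints x Finset.univ) *
        ∏ i, (A (c i)).indicator 1 (ω.addPoints x Finset.univ, x i) ∂P with hG
    have hGm : Measurable G := by
      refine Measurable.lintegral_prod_left' (f := fun p : Configuration X × (Fin (n + 1) → X) =>
        W (p.1.addPoints p.2 Finset.univ) *
        ∏ i, (A (c i)).indicator 1 (p.1.addPoints p.2 Finset.univ, p.2 i)) ?_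
      refine (hW.comp (measurable_addPoints _)).mul (Finset.measurable_prod _ fun i _ => ?_)
      exact (measurable_one.indicator (hA (c i))).comp ((measurable_addPoints _).prodMk
        ((measurable_pi_apply i).comp measurable_snd))
    have hmp := (measurePreserving_piFinSuccAbove (fun _ : Fin (n + 1) => σ) 0).symm
    rw [← hmp.lintegral_comp hGm, lintegral_prod (fun a => G _) (hGm.comp hmp.measurable).aemeasurable]
    refine lintegral_congr fun y => lintegral_congr fun x' => ?_
    simp [hG, MeasurableEquiv.piFinSuccAbove, Fin.insertNthEquiv]

end Moments

/-! ### Finite differences and inclusion-exclusion -/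

section Differences

variable {X : Type*} [TopologicalSpace X] [MeasurableSpace X]

theorem Configuration.addPoints_map {ι κ : Type*} (e : ι ↪ κ) (x : κ → X) (η : Finset ι)
    (ω : Configuration X) : ω.addPoints x (η.map e) = ω.addPoints (fun i => x (e i)) η := by
  apply Subtype.ext
  simp [addPoints]

theorem diff_map {ι κ : Type*} (e : ι ↪ κ) (x : κ → X) (Θ : Finset ι)
    (F : Configuration X → ℝ) (ω : Configuration X) :
    diff x (Θ.map e) F ω = diff (fun i => x (e i)) Θ F ω := by
  have : (Θ.map e).powerset = Θ.powerset.map (Finset.mapEmbedding e).toEmbedding := by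
    ext η
    simp only [Finset.mem_powerset, Finset.mem_map, RelEmbedding.coe_toEmbedding,
      Finset.mapEmbedding_apply, Finset.subset_map_iff]
    exact ⟨fun ⟨u, hu, h⟩ => ⟨u, hu, h.symm⟩, fun ⟨u, hu, h⟩ => ⟨u, hu, h.symm⟩⟩
  simp only [diff, this, Finset.sum_map, RelEmbedding.coe_toEmbedding, Finset.mapEmbedding_apply,
    Finset.card_map, Configuration.addPoints_map]

/-- Möbius inversion of the iterated differences. -/
theorem sum_powerset_diff {ι : Type*} [DecidableEq ι] (x : ι → X) (U : Finset ι)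
    (F : Configuration X → ℝ) (ω : Configuration X) :
    ∑ Θ ∈ U.powerset, diff x Θ F ω = F (ω.addPoints x U) := by
  induction U using Finset.induction_on generalizing ω with
  | empty => simp [diff_empty]
  | insert a U ha ih =>
    rw [Finset.sum_powerset_insert ha, ← Finset.sum_add_distrib]
    have : ∀ Θ ∈ U.powerset, diff x Θ F ω + diff x (insert a Θ) F ω =
        diff x Θ F (ω.addPoints x {a}) := by
      intro Θ hΘ
      rw [diff_insert x (fun h => ha (Finset.mem_powerset.1 hΘ h))]
      ring
    rw [Finset.sum_congr rfl this, ih]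
    congr 1
    apply Subtype.ext
    simp [Configuration.addPoints, Finset.sum_insert ha, add_assoc]

/-- Relabelling to an arbitrary finite index type lets the later induction pass to subfamilies
indexed by subtypes. -/
theorem CyclicCondition.prod_diff_eq_zero {Y : Type*} [MeasurableSpace Y]
    {τ : Configuration X → X → Y} (hτ : CyclicCondition τ) {ι : Type*} [Fintype ι] [Nonempty ι]
    (Θ : ι → Finset ι) (hne : ∀ i, (Θ i).Nonempty) (hcov : ∀ j, ∃ i, j ∈ Θ i) (x : ι → X)
    (ω : Configuration X) (h : ι → Y → ℝ) (hm : ∀ i, Measurable (h i))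
    (hb : ∀ i, ∃ C : ℝ, ∀ y, |h i y| ≤ C) :
    ∏ i, diff x (Θ i) (fun ω' => h i (τ ω' (x i))) ω = 0 := by
  let e := Fintype.equivFin ι
  have := hτ (Fintype.card ι) Fintype.card_pos (fun i => (Θ (e.symm i)).map e.toEmbedding)
    (fun i => (hne _).map) (by
      rw [Set.eq_univ_iff_forall]
      intro j
      obtain ⟨i, hi⟩ := hcov (e.symm j)
      refine Set.mem_iUnion.2 ⟨e i, Finset.mem_coe.2 (Finset.mem_map.2 ⟨e.symm j, ?_, by simp⟩)⟩
      simpa using hi)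
    (fun i => x (e.symm i)) ω (fun i => h (e.symm i)) (fun i => hm _) (fun i => hb _)
  rw [← this, ← e.symm.prod_comp]
  refine Finset.prod_congr rfl fun i _ => ?_
  rw [diff_map]
  simp

end Differences

/-- Pair `U` with `insert j U` for some `j ∉ V`: the two contain `V` simultaneously and have
opposite signs. -/
theorem sum_powerset_neg_one_pow_superset {ι : Type*} [Fintype ι] [DecidableEq ι] (V : Finset ι)
    (hV : V ≠ Finset.univ) :
    ∑ U : Finset ι, (if V ⊆ U then (-1 : ℝ) ^ U.card else 0) = 0 := by
  obtain ⟨j, hj⟩ : ∃ j, j ∉ V := by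
    by_contra! h
    exact hV (Finset.eq_univ_iff_forall.2 h)
  rw [← Finset.powerset_univ, ← Finset.insert_erase (Finset.mem_univ j),
    Finset.sum_powerset_insert (Finset.notMem_erase j _), ← Finset.sum_add_distrib]
  refine Finset.sum_eq_zero fun U hU => ?_
  have hjU : j ∉ U := fun h => Finset.notMem_erase j _ (Finset.mem_powerset.1 hU h)
  simp only [Finset.subset_insert_iff_of_notMem hj, Finset.card_insert_of_notMem hjU]
  split_ifs
  · ring
  · simp

/-- Inclusion-exclusion: if the products of the Möbius transforms of `a i` vanish over all covers by
nonempty sets, then so does the alternating sum of the products of the increments of `a i`. -/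
theorem sum_neg_one_pow_prod_sub_eq_zero {ι : Type*} [Fintype ι] [DecidableEq ι]
    (d a : ι → Finset ι → ℝ) (had : ∀ i U, ∑ Θ ∈ U.powerset, d i Θ = a i U)
    (h : ∀ Θ : ι → Finset ι, (∀ i, (Θ i).Nonempty) → (∀ j, ∃ i, j ∈ Θ i) → ∏ i, d i (Θ i) = 0) :
    ∑ U : Finset ι, (-1 : ℝ) ^ U.card * ∏ i, (a i U - a i ∅) = 0 := by
  have h1 : ∀ i U, a i U - a i ∅ = ∑ Θ : Finset ι, if Θ ⊆ U ∧ Θ.Nonempty then d i Θ else 0 := by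
    intro i U
    rw [← had, ← had, Finset.powerset_empty, Finset.sum_singleton,
      ← Finset.add_sum_erase _ _ (Finset.empty_mem_powerset U), add_sub_cancel_left,
      ← Finset.sum_filter]
    refine Finset.sum_congr ?_ fun _ _ => rfl
    ext Θ
    simp [Finset.nonempty_iff_ne_empty, and_comm]
  simp_rw [h1, Fintype.prod_sum, Finset.mul_sum]
  rw [Finset.sum_comm]
  refine Finset.sum_eq_zero fun Θ _ => ?_
  by_cases hne : ∀ i, (Θ i).Nonempty
  swap
  · push Not at hne
    obtain ⟨i, hi⟩ := hne
    refine Finset.sum_eq_zero fun U _ => ?_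
    rw [Finset.prod_eq_zero (Finset.mem_univ i), mul_zero]
    simp [hi]
  -- With `Θ` fixed, only the `U` containing `⋃ Θ i` contribute. If that union is not everything the
  -- signs cancel; otherwise `h` applies.
  have h2 : ∀ U : Finset ι, (-1 : ℝ) ^ U.card *
      ∏ i, (if Θ i ⊆ U ∧ (Θ i).Nonempty then d i (Θ i) else 0) =
      (if Finset.univ.biUnion Θ ⊆ U then (-1 : ℝ) ^ U.card else 0) * ∏ i, d i (Θ i) := by
    intro U
    simp only [hne, and_true]
    rw [Finset.prod_ite_zero]
    simp only [Finset.biUnion_subset]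
    split_ifs <;> simp
  simp_rw [h2]
  rw [← Finset.sum_mul]
  by_cases hV : Finset.univ.biUnion Θ = Finset.univ
  · rw [h Θ hne fun j => by simpa using hV.ge (Finset.mem_univ j), mul_zero]
  · rw [sum_powerset_neg_one_pow_superset _ hV, zero_mul]

/-- Integrate the pointwise relation and subtract `c` times the relation between the coefficients:
what remains is `s q₀ * (m (E q₀) - c) = 0`. -/
theorem measure_eq_of_sum_indicator_eq_zero {α Q : Type*} [MeasurableSpace α] [Fintype Q]
    [DecidableEq Q] {m : Measure α} {E : Q → Set α} (hE : ∀ q, MeasurableSet (E q)) {s : Q → ℝ}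
    (hs0 : ∀ q, s q ≠ 0) (hs : ∑ q, s q = 0)
    (h : ∀ a, ∑ q, s q * (E q).indicator 1 a = 0) (q₀ : Q) {c : ℝ≥0∞} (hc : c ≠ ∞)
    (hq : ∀ q, q ≠ q₀ → m (E q) = c) : m (E q₀) = c := by
  -- Integrability needs `m (E q₀)` finite beforehand. A point in `E q₀` and in no other set would
  -- leave the single term `s q₀ ≠ 0`.
  have hsub : E q₀ ⊆ ⋃ q ∈ Finset.univ.erase q₀, E q := by
    intro a ha
    by_contra hcon
    simp only [Finset.mem_erase, Finset.mem_univ, and_true, Set.mem_iUnion, not_exists] at hcon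
    have := h a
    rw [Finset.sum_eq_single q₀ (fun q _ hq => by
      rw [Set.indicator_of_notMem (hcon q hq), mul_zero]) (by simp),
      Set.indicator_of_mem ha] at this
    simp [hs0] at this
  have hfin : ∀ q, m (E q) ≠ ∞ := by
    intro q
    by_cases hqq : q = q₀
    · subst hqq
      refine ((measure_mono hsub).trans_lt ?_).ne
      refine (measure_biUnion_finset_le _ _).trans_lt (ENNReal.sum_lt_top.2 fun r hr => ?_)
      rw [hq r (Finset.ne_of_mem_erase hr)]
      exact hc.lt_top
    · rw [hq q hqq]; exact hc
  have hint : ∀ q, Integrable (fun a => s q * (E q).indicator (1 : α → ℝ) a) m := fun q =>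
    ((integrable_indicator_iff (hE q)).2 (integrableOn_const (hfin q))).const_mul _
  have h0 : ∑ q, s q * m.real (E q) = 0 := by
    have := integral_finsetSum Finset.univ fun q _ => hint q
    simp only [h, integral_zero, integral_const_mul, integral_indicator_one (hE _)] at this
    exact this.symm
  rw [← Finset.add_sum_erase _ _ (Finset.mem_univ q₀)] at h0 hs
  have h1 : ∑ q ∈ Finset.univ.erase q₀, s q * m.real (E q) =
      (∑ q ∈ Finset.univ.erase q₀, s q) * c.toReal := by
    rw [Finset.sum_mul]
    refine Finset.sum_congr rfl fun q hq' => ?_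
    rw [measureReal_def, hq q (Finset.ne_of_mem_erase hq')]
  rw [h1] at h0
  have h2 : s q₀ * (m.real (E q₀) - c.toReal) = 0 := by linear_combination h0 - c.toReal * hs
  have h3 := (mul_eq_zero.1 h2).resolve_left (hs0 q₀)
  rw [← ENNReal.ofReal_toReal (hfin q₀), ← ENNReal.ofReal_toReal hc]
  rw [measureReal_def] at h3
  rw [sub_eq_zero.1 h3]

/-- Fubini for a subset of a power of a measure space whose sections in the coordinates outside `p`
have constant measure. -/
theorem measure_pi_eq_mul_of_sections {ι X : Type*} [Fintype ι] [MeasurableSpace X]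
    {σ : Measure X} [SigmaFinite σ] (p : ι → Prop) [DecidablePred p] {E : Set (ι → X)}
    (hE : MeasurableSet E) {G : Set ({i // p i} → X)} (hG : MeasurableSet G)
    (R : ({i // p i} → X) → Set ({i // ¬ p i} → X))
    (h : ∀ x, x ∈ E ↔ (fun i : {i // p i} => x i) ∈ G ∧
      (fun i : {i // ¬ p i} => x i) ∈ R fun i : {i // p i} => x i) {b : ℝ≥0∞}
    (hR : ∀ y, Measure.pi (fun _ => σ) (R y) = b) :
    Measure.pi (fun _ => σ) E = Measure.pi (fun _ => σ) G * b := by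
  classical
  have hmp := (measurePreserving_piEquivPiSubtypeProd (fun _ : ι => σ) p).symm
  rw [← hmp.measure_preimage hE.nullMeasurableSet, Measure.prod_apply (hmp.measurable hE)]
  have : ∀ y, Measure.pi (fun _ => σ) (Prod.mk y ⁻¹'
      ((MeasurableEquiv.piEquivPiSubtypeProd (fun _ : ι => X) p).symm ⁻¹' E)) =
      G.indicator (fun _ => b) y := by
    intro y
    have hset : Prod.mk y ⁻¹' ((MeasurableEquiv.piEquivPiSubtypeProd
        (fun _ : ι => X) p).symm ⁻¹' E) = {z | y ∈ G ∧ z ∈ R y} := by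
      ext z
      have hx := (MeasurableEquiv.piEquivPiSubtypeProd
        (fun _ : ι => X) p).apply_symm_apply (y, z)
      set x := (MeasurableEquiv.piEquivPiSubtypeProd (fun _ : ι => X) p).symm (y, z) with hxdef
      have h1 : (fun i : {i // p i} => x i) = y := congrArg Prod.fst hx
      have h2 : (fun i : {i // ¬ p i} => x i) = z := congrArg Prod.snd hx
      simp only [Set.mem_preimage, Set.mem_ofPred_eq, ← hxdef, h, h1, h2]
    rw [hset]
    by_cases hy : y ∈ G <;> simp [hy, hR]
  simp_rw [this]
  rw [lintegral_indicator_const hG, mul_comm]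

/-! ### The measure of families moved by the enriched configuration -/

section Transform

variable {X Y : Type*} [TopologicalSpace X] [MeasurableSpace X] [MeasurableSpace Y]
  {σ : Measure X} {μ : Measure Y} {τ : Configuration X → X → Y}

theorem measurable_transform {α : Type*} [MeasurableSpace α]
    (hτ : Measurable fun p : Configuration X × X => τ p.1 p.2)
    {f : α → Configuration X} {g : α → X} (hf : Measurable f) (hg : Measurable g) :
    Measurable fun a => τ (f a) (g a) := hτ.comp (hf.prodMk hg)

theorem measure_pi_transform_const [SigmaFinite σ]
    (hτ : Measurable fun p : Configuration X × X => τ p.1 p.2) (hmap : ∀ ω, σ.map (τ ω) = μ)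
    {ι : Type*} [Fintype ι] (ω : ι → Configuration X) {B : ι → Set Y}
    (hB : ∀ i, MeasurableSet (B i)) :
    Measure.pi (fun _ => σ) {x : ι → X | ∀ i, τ (ω i) (x i) ∈ B i} = ∏ i, μ (B i) := by
  have : {x : ι → X | ∀ i, τ (ω i) (x i) ∈ B i} = Set.univ.pi fun i => τ (ω i) ⁻¹' B i := by
    ext x; simp
  rw [this, Measure.pi_pi]
  refine Finset.prod_congr rfl fun i _ => ?_
  have hτω : Measurable (τ (ω i)) := hτ.comp measurable_prodMk_left
  rw [← hmap (ω i), Measure.map_apply hτω (hB i)]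

theorem Configuration.addPoints_subtype {ι : Type*} [Fintype ι] (p : ι → Prop) [DecidablePred p]
    (ω : Configuration X) (x : ι → X) : ω.addPoints x Finset.univ =
      (ω.addPoints (fun i : {i // p i} => x i) Finset.univ).addPoints
        (fun i : {i // ¬ p i} => x i) Finset.univ := by
  apply Subtype.ext
  simp only [addPoints]
  rw [add_assoc, Fintype.sum_subtype_add_sum_subtype p fun i => Measure.dirac (x i)]

theorem Configuration.addPoints_subtype_mem {ι : Type*} [DecidableEq ι] (U : Finset ι)
    (ω : Configuration X) (x : ι → X) : ω.addPoints x U =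
      ω.addPoints (fun i : {i // i ∈ U} => x i) Finset.univ := by
  apply Subtype.ext
  simp only [addPoints]
  rw [Finset.univ_eq_attach, Finset.sum_attach U fun i => Measure.dirac (x i)]

theorem measurableSet_transform_mem (hτ : Measurable fun p : Configuration X × X => τ p.1 p.2)
    {ι : Type*} [Finite ι] {B : ι → Set Y} (hB : ∀ i, MeasurableSet (B i))
    {f : ι → (ι → X) → Configuration X} (hf : ∀ i, Measurable (f i)) :
    MeasurableSet {x : ι → X | ∀ i, τ (f i x) (x i) ∈ B i} := by
  rw [Set.ofPred_forall]
  exact MeasurableSet.iInter fun i =>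
    measurable_transform hτ (hf i) (measurable_pi_apply i) (hB i)

theorem measurable_addPoints_right {ι : Type*} (ω : Configuration X) (U : Finset ι) :
    Measurable fun x : ι → X => ω.addPoints x U :=
  (measurable_addPoints U).comp measurable_prodMk_left

/-- Fix the coordinates in `s` and absorb them into `ω`: the others then form a smaller instance of
the full problem, whose value `ih` makes independent of the fixed points. The coordinates in `s`,
moved by `ω` alone, contribute a box. Hence `ih` is required for every configuration. -/
theorem measure_pi_transform_split [SigmaFinite σ]
    (hτ : Measurable fun p : Configuration X × X => τ p.1 p.2) (hmap : ∀ ω, σ.map (τ ω) = μ)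
    {ι : Type*} [Fintype ι] (s : ι → Prop) [DecidablePred s]
    {B : ι → Set Y} (hB : ∀ i, MeasurableSet (B i))
    (ih : ∀ ω : Configuration X, Measure.pi (fun _ => σ) {x : {i // ¬ s i} → X |
      ∀ i : {i // ¬ s i}, τ (ω.addPoints x Finset.univ) (x i) ∈ B i} = ∏ i : {i // ¬ s i}, μ (B i))
    (ω : Configuration X) :
    Measure.pi (fun _ => σ) {x : ι → X |
      ∀ i, τ (if s i then ω else ω.addPoints x Finset.univ) (x i) ∈ B i} = ∏ i, μ (B i) := by
  rw [measure_pi_eq_mul_of_sections s (measurableSet_transform_mem hτ hB fun i => by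
      split_ifs
      exacts [measurable_const, measurable_addPoints_right _ _])
    (G := {y | ∀ i : {i // s i}, τ ω (y i) ∈ B i})
    (measurableSet_transform_mem hτ (fun i => hB _) fun _ => measurable_const)
    (fun y => {z : {i // ¬ s i} → X |
      ∀ i : {i // ¬ s i}, τ ((ω.addPoints y Finset.univ).addPoints z Finset.univ) (z i) ∈ B i}) ?_
    (fun y => ih _), measure_pi_transform_const hτ hmap (fun _ => ω) fun i => hB _,
    Fintype.prod_subtype_mul_prod_subtype s fun i => μ (B i)]
  intro x
  simp only [Set.mem_ofPred_eq, ← Configuration.addPoints_subtype s ω x]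
  constructor
  · exact fun h => ⟨fun i => by simpa [i.2] using h i, fun i => by simpa [i.2] using h i⟩
  · rintro ⟨h1, h2⟩ i
    by_cases hi : s i
    · simpa [hi] using h1 ⟨i, hi⟩
    · simpa [hi] using h2 ⟨i, hi⟩

/-- Coordinates outside `U` never enter the configuration. Once those in `U` are fixed they range
over a box of constant measure, so they can be integrated out. -/
theorem measure_pi_transform_restrict [SigmaFinite σ]
    (hτ : Measurable fun p : Configuration X × X => τ p.1 p.2) (hmap : ∀ ω, σ.map (τ ω) = μ)
    {ι : Type*} [Fintype ι] [DecidableEq ι] (s : ι → Prop) [DecidablePred s] (U : Finset ι)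
    {B : ι → Set Y} (hB : ∀ i, MeasurableSet (B i)) (ω : Configuration X)
    (ih : Measure.pi (fun _ => σ) {x : {i // i ∈ U} → X |
      ∀ i : {i // i ∈ U}, τ (if s i then ω else ω.addPoints x Finset.univ) (x i) ∈ B i} =
        ∏ i : {i // i ∈ U}, μ (B i)) :
    Measure.pi (fun _ => σ) {x : ι → X |
      ∀ i, τ (if s i then ω else ω.addPoints x U) (x i) ∈ B i} = ∏ i, μ (B i) := by
  refine (measure_pi_eq_mul_of_sections (· ∈ U) (measurableSet_transform_mem hτ hB fun i => by
      split_ifs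
      exacts [measurable_const, measurable_addPoints_right _ _])
    (G := {y | ∀ i : {i // i ∈ U}, τ (if s i then ω else ω.addPoints y Finset.univ) (y i) ∈ B i})
    (measurableSet_transform_mem hτ (fun i => hB _) fun i => by
      split_ifs
      exacts [measurable_const, measurable_addPoints_right _ _])
    (fun y => {z : {i // i ∉ U} → X |
      ∀ i : {i // i ∉ U}, τ (if s i then ω else ω.addPoints y Finset.univ) (z i) ∈ B i}) ?_
    (fun y => measure_pi_transform_const hτ hmap _ fun i => hB _)).trans ?_
  swap
  · rw [← Fintype.prod_subtype_mul_prod_subtype (· ∈ U) fun i => μ (B i)]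
    congr 1
    convert ih
  intro x
  simp only [Set.mem_ofPred_eq, ← Configuration.addPoints_subtype_mem U ω x]
  constructor
  · exact fun h => ⟨fun i => h i, fun i => h i⟩
  · rintro ⟨h1, h2⟩ i
    by_cases hi : i ∈ U
    · exact h1 ⟨i, hi⟩
    · exact h2 ⟨i, hi⟩

/-- Under the cyclic condition the points of a finite family, moved by the transformation of the
configuration enriched with the family, are still independent with intensity `μ`. -/
theorem CyclicCondition.measure_pi_transform [SigmaFinite σ]
    (hτ : Measurable fun p : Configuration X × X => τ p.1 p.2) (hmap : ∀ ω, σ.map (τ ω) = μ)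
    (hc : CyclicCondition τ) {ι : Type*} [Fintype ι] {B : ι → Set Y}
    (hB : ∀ i, MeasurableSet (B i)) (hfin : ∀ i, μ (B i) ≠ ∞) (ω : Configuration X) :
    Measure.pi (fun _ => σ) {x : ι → X |
      ∀ i, τ (ω.addPoints x Finset.univ) (x i) ∈ B i} = ∏ i, μ (B i) := by
  classical
  induction hn : Fintype.card ι using Nat.strong_induction_on generalizing ι ω with
  | _ n ih =>
  subst hn
  rcases isEmpty_or_nonempty ι with hι | hι
  · rw [Measure.pi_of_empty (fun _ => σ) isEmptyElim]
    simp
  -- In a pair `(U, S)`, the points of `U` are added and `S` collects the factors where `a_i(∅)` is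
  -- chosen in the expansion. The target is `(univ, ∅)`.
  let E : Finset ι × Finset ι → Set (ι → X) := fun q =>
    {x | ∀ i, τ (if i ∈ q.2 then ω else ω.addPoints x q.1) (x i) ∈ B i}
  have hE : ∀ q, MeasurableSet (E q) := fun q => measurableSet_transform_mem hτ hB fun i => by
    split_ifs
    exacts [measurable_const, measurable_addPoints_right _ _]
  -- One sign comes from the alternating sum over `U`, the other from expanding the product of
  -- increments.
  let sgn : Finset ι × Finset ι → ℝ := fun q => (-1) ^ q.1.card * (-1) ^ q.2.card
  have hsgn : ∑ q, sgn q = 0 := by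
    rw [Fintype.sum_prod_type]
    simp only [sgn, ← Finset.mul_sum, ← Finset.sum_mul]
    have := sum_powerset_neg_one_pow_superset (∅ : Finset ι) Finset.univ_nonempty.ne_empty.symm
    simp only [Finset.empty_subset, if_true] at this
    rw [this, zero_mul]
  have hind : ∀ x : ι → X, ∑ q, sgn q * (E q).indicator 1 x = 0 := by
    intro x
    let h : ι → Y → ℝ := fun i => (B i).indicator 1
    have key := sum_neg_one_pow_prod_sub_eq_zero
      (fun i Θ => diff x Θ (fun ω' => h i (τ ω' (x i))) ω)
      (fun i U => h i (τ (ω.addPoints x U) (x i)))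
      (fun i U => sum_powerset_diff x U _ ω)
      fun Θ hne hcov => hc.prod_diff_eq_zero Θ hne hcov x ω h
        (fun i => measurable_one.indicator (hB i))
        fun i => ⟨1, fun y => by
          by_cases hy : y ∈ B i <;> simp [h, hy]⟩
    rw [Fintype.sum_prod_type, ← key]
    refine Finset.sum_congr rfl fun U _ => ?_
    rw [Finset.prod_sub, Finset.powerset_univ, Finset.mul_sum]
    refine Finset.sum_congr rfl fun S _ => ?_
    simp only [sgn, mul_assoc]
    congr 2
    have hprod : (E (U, S)).indicator 1 x =
        ∏ i, h i (τ (if i ∈ S then ω else ω.addPoints x U) (x i)) := by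
      by_cases hx : x ∈ E (U, S)
      · rw [Set.indicator_of_mem hx, Finset.prod_eq_one fun i _ => Set.indicator_of_mem (hx i) _]
        rfl
      · rw [Set.indicator_of_notMem hx]
        obtain ⟨i, hi⟩ := not_forall.1 hx
        exact (Finset.prod_eq_zero (Finset.mem_univ i) (Set.indicator_of_notMem hi _)).symm
    rw [hprod, ← Finset.prod_sdiff (Finset.subset_univ S)]
    congr 1
    · exact Finset.prod_congr rfl fun i hi => by rw [if_neg (Finset.mem_sdiff.1 hi).2]
    · exact Finset.prod_congr rfl fun i hi => by rw [if_pos hi, Configuration.addPoints_empty]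
  have hmain := measure_eq_of_sum_indicator_eq_zero (m := Measure.pi fun _ => σ) hE
    (s := sgn) (fun q => by simp [sgn]) hsgn hind (Finset.univ, ∅)
    (c := ∏ i, μ (B i)) (ENNReal.prod_ne_top fun i _ => hfin i) ?_
  · simpa [E] using hmain
  · rintro ⟨U, S⟩ hne
    -- If `U` is everything, `S` is non-empty and splitting it off leaves fewer points. Otherwise
    -- the points outside `U` are integrated out first, which already lowers the cardinality, so `S`
    -- may be empty.
    by_cases hU : U = Finset.univ
    · subst hU
      have hS : S.Nonempty := by
        rw [Finset.nonempty_iff_ne_empty]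
        rintro rfl
        exact hne rfl
      obtain ⟨j, hj⟩ := hS
      exact measure_pi_transform_split hτ hmap (· ∈ S) hB (fun ω' =>
        ih _ (Fintype.card_subtype_lt (x := j) (not_not.2 hj)) (fun i => hB _)
          (fun i => hfin _) ω' rfl) ω
    · obtain ⟨j, hj⟩ : ∃ j, j ∉ U := by
        by_contra! h
        exact hU (Finset.eq_univ_iff_forall.2 h)
      refine measure_pi_transform_restrict hτ hmap (· ∈ S) U hB ω ?_
      refine measure_pi_transform_split hτ hmap (fun i : {i // i ∈ U} => i.1 ∈ S)
        (fun i => hB _) (fun ω' => ?_) ω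
      exact ih _ ((Fintype.card_subtype_le _).trans_lt (Fintype.card_subtype_lt (x := j) hj))
        (fun i => hB _) (fun i => hfin _) ω' rfl

end Transform

/-! ### Poisson laws from factorial moments -/

/-- For `M ≥ j` the terms equal `(-1)^i * choose M j * choose (M - j) i`, and the alternating
binomial sum vanishes unless `M = j`. Only finitely many terms are non-zero. -/
theorem tsum_alternating_descFactorial (M j : ℕ) :
    ∑' i, (-1 : ℝ) ^ i * (M.descFactorial (j + i) : ℝ) / (j.factorial * i.factorial) =
      if M = j then 1 else 0 := by
  have hzero : ∀ i, i ∉ Finset.range (M - j + 1) →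
      (-1 : ℝ) ^ i * (M.descFactorial (j + i) : ℝ) / (j.factorial * i.factorial) = 0 := by
    intro i hi
    rw [Finset.mem_range, not_lt] at hi
    rw [Nat.descFactorial_eq_zero_iff_lt.2 (by omega)]
    simp
  rw [tsum_eq_sum hzero]
  rcases lt_or_ge M j with hlt | hge
  · rw [if_neg hlt.ne]
    refine Finset.sum_eq_zero fun i _ => ?_
    rw [Nat.descFactorial_eq_zero_iff_lt.2 (by omega)]
    simp
  · obtain ⟨r, rfl⟩ := Nat.exists_eq_add_of_le hge
    have hterm : ∀ i, (-1 : ℝ) ^ i * ((j + r).descFactorial (j + i) : ℝ) /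
        (j.factorial * i.factorial) = (j + r).choose j * ((-1 : ℝ) ^ i * r.choose i) := by
      intro i
      have h1 : (j + r).descFactorial (j + i) =
          (j + r).descFactorial j * r.descFactorial i := by
        rw [← Nat.descFactorial_mul_descFactorial (Nat.le_add_right j i)]
        simp [mul_comm]
      rw [h1, Nat.descFactorial_eq_factorial_mul_choose, Nat.descFactorial_eq_factorial_mul_choose]
      have := Nat.factorial_ne_zero j
      have := Nat.factorial_ne_zero i
      push_cast
      field_simp
    simp_rw [hterm]
    rw [← Finset.mul_sum, Nat.add_sub_cancel_left]
    have halt := Int.alternating_sum_range_choose (n := r)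
    have halt' : ∑ i ∈ Finset.range (r + 1), (-1 : ℝ) ^ i * (r.choose i : ℝ) =
        if r = 0 then 1 else 0 := by
      exact_mod_cast congrArg (Int.cast : ℤ → ℝ) halt
    rw [halt']
    by_cases hr : r = 0 <;> simp [hr]

/-- A measure for which a natural-valued function has the factorial moments of a Poisson law, up to
a constant factor, gives that function the Poisson law, up to the same factor. -/
theorem measure_eq_of_factorial_moments {Ω : Type*} [MeasurableSpace Ω] {Q : Measure Ω}
    {M : Ω → ℕ} (hM : Measurable M) {C r : ℝ≥0}
    (h : ∀ n, ∫⁻ ω, ((M ω).descFactorial n : ℝ≥0∞) ∂Q = C * r ^ n) (j : ℕ) :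
    Q {ω | M ω = j} = C * poissonMeasure r {j} := by
  have hfin : IsFiniteMeasure Q := ⟨by simpa using (h 0).trans_lt (by simp)⟩
  let F : ℕ → Ω → ℝ := fun i ω =>
    (-1 : ℝ) ^ i * ((M ω).descFactorial (j + i) : ℝ) / (j.factorial * i.factorial)
  have hD : ∀ n, Measurable fun ω => ((M ω).descFactorial n : ℝ) := fun n =>
    (measurable_from_nat (f := fun k : ℕ => (k.descFactorial n : ℝ))).comp hM
  have hDint : ∀ n, Integrable (fun ω => ((M ω).descFactorial n : ℝ)) Q := by
    intro n
    refine ⟨(hD n).aestronglyMeasurable, ?_⟩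
    rw [HasFiniteIntegral]
    have : ∀ ω, ‖((M ω).descFactorial n : ℝ)‖ₑ = ((M ω).descFactorial n : ℝ≥0∞) := fun ω => by
      rw [Real.enorm_natCast]
    simp_rw [this, h]
    exact ENNReal.mul_lt_top ENNReal.coe_lt_top (ENNReal.pow_lt_top ENNReal.coe_lt_top)
  have hDval : ∀ n, ∫ ω, ((M ω).descFactorial n : ℝ) ∂Q = C * r ^ n := by
    intro n
    rw [integral_eq_lintegral_of_nonneg_ae (Filter.Eventually.of_forall fun ω => by positivity)
      (hD n).aestronglyMeasurable]
    simp_rw [ENNReal.ofReal_natCast, h]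
    simp
  have hFint : ∀ i, Integrable (F i) Q := fun i => ((hDint _).const_mul _).div_const _
  have hFval : ∀ i, ∫ ω, F i ω ∂Q =
      (C * r ^ j / j.factorial) * ((-r : ℝ) ^ i / i.factorial) := by
    intro i
    simp only [F]
    rw [integral_div, integral_const_mul, hDval, neg_pow (r : ℝ), pow_add]
    field_simp
  have hFnorm : ∀ i, ∫ ω, ‖F i ω‖ ∂Q =
      (C * r ^ j / j.factorial) * ((r : ℝ) ^ i / i.factorial) := by
    intro i
    have : ∀ ω, ‖F i ω‖ = ((M ω).descFactorial (j + i) : ℝ) / (j.factorial * i.factorial) := by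
      intro ω
      simp [F]
    simp_rw [this]
    rw [integral_div, hDval, pow_add]
    field_simp
  -- The norms sum like an exponential series, which permits integrating the expansion of the
  -- indicator of `M = j` term by term.
  have hsum := hasSum_integral_of_summable_integral_norm hFint (by
    simp_rw [hFnorm]
    exact (Real.summable_pow_div_factorial _).mul_left _)
  simp only [F, tsum_alternating_descFactorial] at hsum
  have hexp : HasSum (fun i => ∫ ω, F i ω ∂Q)
      ((C * r ^ j / j.factorial) * Real.exp (-r)) := by
    simp_rw [hFval]
    have := NormedSpace.expSeries_div_hasSum_exp (-r : ℝ)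
    rw [← Real.exp_eq_exp_ℝ] at this
    exact this.mul_left _
  have heq := hsum.unique hexp
  have hset : MeasurableSet {ω | M ω = j} := hM (measurableSet_singleton j)
  have hind : (fun ω => if M ω = j then (1 : ℝ) else 0) = {ω | M ω = j}.indicator 1 := by
    ext ω
    simp [Set.indicator_apply]
  rw [hind, integral_indicator_one hset] at heq
  rw [poissonMeasure_singleton, ← ENNReal.ofReal_toReal (measure_ne_top Q {ω | M ω = j}),
    ← measureReal_def, heq, ← ENNReal.ofReal_coe_nnreal (p := C),
    ← ENNReal.ofReal_mul (by positivity)]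
  congr 1
  ring

/-- Natural-valued random variables with the joint factorial moments of independent Poisson
variables are independent Poisson variables. -/
theorem map_eq_pi_poissonMeasure {Ω K : Type*} [MeasurableSpace Ω] [Fintype K] {P : Measure Ω}
    {M : K → Ω → ℕ} (hM : ∀ k, Measurable (M k)) {r : K → ℝ≥0}
    (h : ∀ m : K → ℕ, ∫⁻ ω, ∏ k, ((M k ω).descFactorial (m k) : ℝ≥0∞) ∂P =
      ∏ k, (r k : ℝ≥0∞) ^ m k) :
    P.map (fun ω k => M k ω) = Measure.pi fun k => poissonMeasure (r k) := by
  classical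
  have hMm : Measurable fun ω k => M k ω := measurable_pi_lambda _ hM
  -- Coordinates in `s` have already been converted into point events; the rest still carry
  -- factorial moments. The induction enlarges `s`.
  let g : Finset K → (K → ℕ) → K → Ω → ℝ≥0∞ := fun s m k ω =>
    if k ∈ s then (if M k ω = m k then 1 else 0) else ((M k ω).descFactorial (m k) : ℝ≥0∞)
  let c : Finset K → (K → ℕ) → K → ℝ≥0∞ := fun s m k =>
    if k ∈ s then poissonMeasure (r k) {m k} else (r k : ℝ≥0∞) ^ m k
  have hg : ∀ s m k, Measurable (g s m k) := fun s m k =>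
    (measurable_from_nat (f := fun n : ℕ =>
      if k ∈ s then (if n = m k then (1 : ℝ≥0∞) else 0) else (n.descFactorial (m k) : ℝ≥0∞))).comp
      (hM k)
  have hc : ∀ s m k, c s m k ≠ ∞ := by
    intro s m k
    simp only [c]
    split_ifs
    exacts [measure_ne_top _ _, ENNReal.pow_ne_top ENNReal.coe_ne_top]
  have key : ∀ s m, ∫⁻ ω, ∏ k, g s m k ω ∂P = ∏ k, c s m k := by
    intro s
    induction s using Finset.induction_on with
    | empty => intro m; simpa [g, c] using h m
    | insert a s ha ih =>
      intro m
      -- The other coordinates become a density. Varying only the order at `a` in the induction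
      -- hypothesis gives, under this density, all factorial moments of `M a` up to the constant
      -- `C`.
      let W : Ω → ℝ≥0∞ := fun ω => ∏ k ∈ Finset.univ.erase a, g s m k ω
      let C : ℝ≥0∞ := ∏ k ∈ Finset.univ.erase a, c s m k
      have hW : Measurable W := Finset.measurable_prod _ fun k _ => hg s m k
      have hC : C ≠ ∞ := ENNReal.prod_ne_top fun k _ => hc s m k
      have hmom : ∀ n, ∫⁻ ω, ((M a ω).descFactorial n : ℝ≥0∞) ∂P.withDensity W =
          C.toNNReal * (r a : ℝ≥0∞) ^ n := by
        intro n
        have := ih (Function.update m a n)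
        simp_rw [← Finset.prod_erase_mul _ _ (Finset.mem_univ a)] at this
        have hne : ∀ k ∈ Finset.univ.erase a, (∀ ω, g s (Function.update m a n) k ω = g s m k ω) ∧
            c s (Function.update m a n) k = c s m k := by
          intro k hk
          simp [g, c, Function.update_of_ne (Finset.ne_of_mem_erase hk)]
        rw [Finset.prod_congr rfl fun k hk => (hne k hk).2] at this
        have h2 : ∀ ω, ∏ k ∈ Finset.univ.erase a, g s (Function.update m a n) k ω = W ω :=
          fun ω => Finset.prod_congr rfl fun k hk => (hne k hk).1 ω
        simp_rw [h2] at this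
        rw [lintegral_withDensity_eq_lintegral_mul _ hW
          (g := fun ω => ((M a ω).descFactorial n : ℝ≥0∞)) ((measurable_from_nat (f := fun k : ℕ => (k.descFactorial n : ℝ≥0∞))).comp (hM a)),
          ENNReal.coe_toNNReal hC]
        simpa [g, c, ha] using this
      have hres := measure_eq_of_factorial_moments (hM a) hmom (m a)
      have hset : MeasurableSet {ω | M a ω = m a} := hM a (measurableSet_singleton _)
      rw [withDensity_apply _ hset, ← lintegral_indicator hset, ENNReal.coe_toNNReal hC] at hres
      have hne : ∀ k ∈ Finset.univ.erase a, (∀ ω, g (insert a s) m k ω = g s m k ω) ∧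
          c (insert a s) m k = c s m k := by
        intro k hk
        simp [g, c, Finset.ne_of_mem_erase hk]
      simp_rw [← Finset.prod_erase_mul _ _ (Finset.mem_univ a)]
      rw [Finset.prod_congr rfl fun k hk => (hne k hk).2]
      refine Eq.trans (lintegral_congr fun ω => ?_) (hres.trans ?_)
      · rw [Finset.prod_congr rfl fun k hk => (hne k hk).1 ω]
        by_cases hω : M a ω = m a <;> simp [g, W, hω]
      · simp [c, C]
  refine Measure.ext_of_singleton fun m => ?_
  have hset : MeasurableSet ((fun ω k => M k ω) ⁻¹' {m}) := hMm (measurableSet_singleton m)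
  rw [Measure.map_apply hMm (measurableSet_singleton m), Measure.pi_singleton,
    ← lintegral_indicator_one hset]
  have h1 := key Finset.univ m
  simp only [g, c, Finset.mem_univ, if_true] at h1
  rw [← h1]
  refine lintegral_congr fun ω => ?_
  rw [Fintype.prod_boole]
  simp [Set.indicator_apply, funext_iff]


/-! ### Integer values and images of point measures -/

section PointMeasure

variable {X : Type*} [TopologicalSpace X] [MeasurableSpace X]

theorem IsPointMeasure.eq_natCast {ω : Measure X} (hω : IsPointMeasure ω) {B : Set X}
    (hB : MeasurableSet B) (hfin : ω B ≠ ∞) : ∃ n : ℕ, ω B = n := by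
  obtain ⟨-, ι, -, x, hx⟩ := hω
  have h : ω B = ((x ⁻¹' B).encard : ℝ≥0∞) := by
    rw [hx, Measure.sum_apply _ hB, ← ENNReal.tsum_set_one, tsum_subtype (x ⁻¹' B) fun _ => (1 : ℝ≥0∞)]
    refine tsum_congr fun i => ?_
    rw [Measure.dirac_apply' _ hB]
    rfl
  have hne : (x ⁻¹' B).encard ≠ ⊤ := fun htop => hfin (by rw [h, htop]; rfl)
  obtain ⟨n, hn⟩ := ENat.ne_top_iff_exists.1 hne
  exact ⟨n, by rw [h, ← hn]; rfl⟩

theorem IsPointMeasure.map {Y : Type*} [TopologicalSpace Y] [MeasurableSpace Y] {ω : Measure X}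
    (hω : IsPointMeasure ω) {f : X → Y} (hf : Measurable f)
    (hfin : IsLocallyFiniteMeasure (ω.map f)) : IsPointMeasure (ω.map f) := by
  obtain ⟨-, ι, hι, x, hx⟩ := hω
  refine ⟨hfin, ι, hι, fun i => f (x i), ?_⟩
  rw [hx, Measure.map_sum hf.aemeasurable]
  simp_rw [Measure.map_dirac' hf]

end PointMeasure

/-! ### The law of the transformed configuration -/

section Push

variable {X Y : Type*} [TopologicalSpace X] [MeasurableSpace X]
  [MeasurableSpace Y] {σ : Measure X} {μ : Measure Y} {τ : Configuration X → X → Y}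
  {P : Measure (Configuration X)}

theorem map_transform_apply (hτ : Measurable fun p : Configuration X × X => τ p.1 p.2)
    (ω : Configuration X) {B : Set Y} (hB : MeasurableSet B) :
    ω.1.map (τ ω) B = ω.1 {x | τ ω x ∈ B} := by
  have hτω : Measurable (τ ω) := hτ.comp measurable_prodMk_left
  rw [Measure.map_apply hτω hB]
  rfl

variable [SecondCountableTopology X] [OpensMeasurableSpace X]

theorem measurable_map_transform_apply
    (hτ : Measurable fun p : Configuration X × X => τ p.1 p.2) {B : Set Y}
    (hB : MeasurableSet B) : Measurable fun ω : Configuration X => ω.1.map (τ ω) B := by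
  simp_rw [map_transform_apply hτ _ hB]
  exact measurable_section_count (A := {p | τ p.1 p.2 ∈ B}) (hτ hB)

variable [SigmaFinite σ]

/-- The transformed process has the joint factorial moments of a Poisson process. -/
theorem IsPoissonMeasure.lintegral_prod_fallingFactorial_map (hP : IsPoissonMeasure σ P)
    (hτ : Measurable fun p : Configuration X × X => τ p.1 p.2) (hmap : ∀ ω, σ.map (τ ω) = μ)
    (hc : CyclicCondition τ) {K : Type*} [Fintype K] {B : K → Set Y}
    (hB : ∀ k, MeasurableSet (B k)) (hfin : ∀ k, μ (B k) ≠ ∞)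
    (hd : Pairwise fun i j => Disjoint (B i) (B j)) (m : K → ℕ) :
    ∫⁻ ω, ∏ k, fallingFactorial (m k) (ω.1.map (τ ω) (B k)) ∂P = ∏ k, μ (B k) ^ m k := by
  classical
  have := hP.isProbabilityMeasure
  let A : K → Set (Configuration X × X) := fun k => {p | τ p.1 p.2 ∈ B k}
  have hA : ∀ k, MeasurableSet (A k) := fun k => hτ (hB k)
  -- One integration variable for each of the `m k` factors at `k`; `c` remembers the set to which a
  -- variable is assigned.
  let e := Fintype.equivFin (Σ k, Fin (m k))
  let c : Fin (Fintype.card (Σ k, Fin (m k))) → K := fun i => (e.symm i).1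
  have hcard : ∀ k, (Finset.univ.filter fun i => c i = k).card = m k := by
    intro k
    have h1 : Fintype.card {i // c i = k} = Fintype.card {s : Σ k, Fin (m k) // s.1 = k} :=
      Fintype.card_congr (e.symm.subtypeEquiv fun i => Iff.rfl)
    rw [← Fintype.card_subtype, h1, Fintype.card_congr (Equiv.sigmaSubtype k)]
    simp
  have h := hP.lintegral_prod_fallingFactorial c hA
    (fun i j hij => (hd hij).preimage fun p : Configuration X × X => τ p.1 p.2) (W := 1)
    measurable_one
  simp only [hcard, Pi.one_apply, one_mul] at h
  simp_rw [map_transform_apply hτ _ (hB _)]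
  refine h.trans ?_
  let E : Set ((Fin (Fintype.card (Σ k, Fin (m k))) → X) × Configuration X) :=
    {p | ∀ i, τ (p.2.addPoints p.1 Finset.univ) (p.1 i) ∈ B (c i)}
  have hEm : MeasurableSet E := by
    simp only [E]
    rw [Set.ofPred_forall]
    exact MeasurableSet.iInter fun i => measurable_transform hτ
      ((measurable_addPoints _).comp measurable_swap)
      ((measurable_pi_apply i).comp measurable_fst) (hB _)
  have hprod : ∀ (x : Fin (Fintype.card (Σ k, Fin (m k))) → X) (ω : Configuration X),
      ∏ i, (A (c i)).indicator (1 : Configuration X × X → ℝ≥0∞) (ω.addPoints x Finset.univ, x i) =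
      E.indicator (fun _ => (1 : ℝ≥0∞)) (x, ω) := by
    intro x ω
    by_cases hx : ∀ i, τ (ω.addPoints x Finset.univ) (x i) ∈ B (c i)
    · rw [Set.indicator_of_mem (show (x, ω) ∈ E from hx),
        Finset.prod_eq_one fun i _ => Set.indicator_of_mem
          (show (ω.addPoints x Finset.univ, x i) ∈ A (c i) from hx i) _]
    · rw [Set.indicator_of_notMem (show (x, ω) ∉ E from hx)]
      obtain ⟨i, hi⟩ := not_forall.1 hx
      exact Finset.prod_eq_zero (Finset.mem_univ i) (Set.indicator_of_notMem
          (show (ω.addPoints x Finset.univ, x i) ∉ A (c i) from hi) _)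
  simp_rw [hprod]
  rw [lintegral_lintegral_swap (f := fun x ω => E.indicator (fun _ => (1 : ℝ≥0∞)) (x, ω))
    (measurable_const.indicator hEm).aemeasurable]
  -- The cyclic condition enters here: the inner integral is the same for every `ω`, so the
  -- expectation is trivial.
  have hin : ∀ ω : Configuration X, ∫⁻ x, E.indicator (fun _ => (1 : ℝ≥0∞)) (x, ω)
      ∂Measure.pi (fun _ => σ) = ∏ i, μ (B (c i)) := by
    intro ω
    rw [← hc.measure_pi_transform hτ hmap (fun i => hB (c i)) (fun i => hfin _) ω]
    exact lintegral_indicator_one (measurable_prodMk_right (y := ω) hEm)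
  simp_rw [hin]
  rw [lintegral_const, measure_univ, mul_one, ← e.prod_comp, Fintype.prod_sigma]
  simp [c]

/-- The first factorial moment is the mean, which equals `μ B`. -/
theorem IsPoissonMeasure.ae_map_transform_lt_top (hP : IsPoissonMeasure σ P)
    (hτ : Measurable fun p : Configuration X × X => τ p.1 p.2) (hmap : ∀ ω, σ.map (τ ω) = μ)
    (hc : CyclicCondition τ) {B : Set Y} (hB : MeasurableSet B) (hfin : μ B ≠ ∞) :
    ∀ᵐ ω ∂P, ω.1.map (τ ω) B < ∞ := by
  have h := hP.lintegral_prod_fallingFactorial_map hτ hmap hc (K := Unit) (fun _ => hB)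
    (fun _ => hfin) (fun i j hij => absurd (Subsingleton.elim i j) hij) fun _ => 1
  simp only [Finset.univ_unique, Finset.prod_singleton, fallingFactorial_succ,
    fallingFactorial_zero, mul_one, pow_one] at h
  exact ae_lt_top (measurable_map_transform_apply hτ hB) (h.trans_ne hfin)

/-- The numbers of points of the transformed process in disjoint sets are independent Poisson
variables. -/
theorem IsPoissonMeasure.map_transform_eq_pi (hP : IsPoissonMeasure σ P)
    (hτ : Measurable fun p : Configuration X × X => τ p.1 p.2) (hmap : ∀ ω, σ.map (τ ω) = μ)
    (hc : CyclicCondition τ) {K : Type*} [Fintype K] {B : K → Set Y}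
    (hB : ∀ k, MeasurableSet (B k)) (hfin : ∀ k, μ (B k) ≠ ∞)
    (hd : Pairwise fun i j => Disjoint (B i) (B j)) :
    P.map (fun ω k => ω.1.map (τ ω) (B k)) =
      Measure.pi fun k => (poissonMeasure (μ (B k)).toNNReal).map (fun n : ℕ => (n : ℝ≥0∞)) := by
  let N : K → Configuration X → ℝ≥0∞ := fun k ω => ω.1.map (τ ω) (B k)
  -- An infinite count is sent to `0`; this happens only on a null set.
  let M : K → Configuration X → ℕ := fun k ω => ⌊(N k ω).toReal⌋₊
  have hN : ∀ k, Measurable (N k) := fun k => measurable_map_transform_apply hτ (hB k)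
  have hM : ∀ k, Measurable (M k) := fun k => Nat.measurable_floor.comp (hN k).ennreal_toReal
  have hNM : ∀ᵐ ω ∂P, ∀ k, N k ω = M k ω := by
    rw [ae_all_iff]
    intro k
    filter_upwards [hP.ae_map_transform_lt_top hτ hmap hc (hB k) (hfin k)] with ω hω
    have hωB := map_transform_apply hτ ω (hB k)
    have hs : MeasurableSet {x | τ ω x ∈ B k} := (hτ.comp measurable_prodMk_left) (hB k)
    obtain ⟨n, hn⟩ := ω.2.eq_natCast hs (hωB ▸ hω.ne)
    have : N k ω = n := hωB.trans hn
    simp [M, this]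
  have hmom : ∀ m : K → ℕ, ∫⁻ ω, ∏ k, ((M k ω).descFactorial (m k) : ℝ≥0∞) ∂P =
      ∏ k, ((μ (B k)).toNNReal : ℝ≥0∞) ^ m k := by
    intro m
    simp_rw [ENNReal.coe_toNNReal (hfin _)]
    rw [← hP.lintegral_prod_fallingFactorial_map hτ hmap hc hB hfin hd m]
    refine lintegral_congr_ae ?_
    filter_upwards [hNM] with ω hω
    refine Finset.prod_congr rfl fun k _ => ?_
    rw [show ω.1.map (τ ω) (B k) = _ from hω k, fallingFactorial_natCast]
  have hpi := map_eq_pi_poissonMeasure hM hmom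
  rw [← Measure.pi_map_pi fun k => AEMeasurable.of_discrete, ← hpi, Measure.map_map .of_discrete
    (measurable_pi_lambda _ hM)]
  refine Measure.map_congr ?_
  filter_upwards [hNM] with ω hω
  exact funext hω

variable [TopologicalSpace Y] [SecondCountableTopology Y] [OpensMeasurableSpace Y]
  [IsLocallyFiniteMeasure μ]

/-- Almost surely the image has finite mass on each of the countably many `U n` with `μ (U n)`
finite, and these cover neighbourhoods of all points. The set `G` of such `ω` is visibly measurable,
which is not established for the set of all `ω` whose image is a point measure. -/
theorem IsPoissonMeasure.exists_measurableSet_isPointMeasure (hP : IsPoissonMeasure σ P)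
    (hτ : Measurable fun p : Configuration X × X => τ p.1 p.2) (hmap : ∀ ω, σ.map (τ ω) = μ)
    (hc : CyclicCondition τ) : ∃ G : Set (Configuration X), MeasurableSet G ∧
      (∀ᵐ ω ∂P, ω ∈ G) ∧ ∀ ω ∈ G, IsPointMeasure (ω.1.map (τ ω)) := by
  obtain ⟨U, hUo, hU⟩ := exists_seq_isOpen_finite Y
  have hm : ∀ n, Measurable fun ω : Configuration X => ω.1.map (τ ω) (U n) := fun n =>
    measurable_map_transform_apply hτ (hUo n).measurableSet
  refine ⟨{ω | ∀ n, μ (U n) ≠ ∞ → ω.1.map (τ ω) (U n) < ∞}, ?_, ?_, ?_⟩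
  · rw [Set.ofPred_forall]
    refine MeasurableSet.iInter fun n => ?_
    by_cases h : μ (U n) = ∞
    · simp [h]
    · simp only [ne_eq, h, not_false_eq_true, true_imp_iff]
      exact hm n measurableSet_Iio
  · simp only [Set.mem_ofPred_eq, ae_all_iff]
    exact fun n hn => hP.ae_map_transform_lt_top hτ hmap hc (hUo n).measurableSet hn
  · intro ω hω
    refine ω.2.map (hτ.comp measurable_prodMk_left) ⟨fun y => ?_⟩
    obtain ⟨n, hyn, hn⟩ := hU μ inferInstance y
    exact ⟨U n, (hUo n).mem_nhds hyn, hω n hn.ne⟩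

end Push
end PoissonTransform

/-! ### The theorem -/

open PoissonTransform in
theorem theorem4p2 {X Y : Type*}
    [TopologicalSpace X] [PolishSpace X] [MeasurableSpace X] [BorelSpace X]
    [TopologicalSpace Y] [PolishSpace Y] [MeasurableSpace Y] [BorelSpace Y]
    (σ : Measure X) [IsLocallyFiniteMeasure σ] (μ : Measure Y) [IsLocallyFiniteMeasure μ]
    (τ : Configuration X → X → Y)
    (hτ_meas : Measurable fun p : Configuration X × X => τ p.1 p.2)
    (hτ_map : ∀ ω, σ.map (τ ω) = μ)
    (hτ_cyclic : CyclicCondition τ)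
    (P : Measure (Configuration X)) (hP : IsPoissonMeasure σ P) :
    (∀ᵐ ω ∂P, ((pushConfig τ ω : Configuration Y) : Measure Y) = (ω : Measure X).map (τ ω)) ∧
    AEMeasurable (pushConfig τ) P ∧
    IsPoissonMeasure μ (P.map (pushConfig τ)) := by
  classical
  have := hP.isProbabilityMeasure
  obtain ⟨G, hG, hGae, hGp⟩ :=
    hP.exists_measurableSet_isPointMeasure hτ_meas hτ_map hτ_cyclic
  have hpush : ∀ ω ∈ G, (pushConfig τ ω).1 = ω.1.map (τ ω) := fun ω hω => by
    rw [pushConfig, dif_pos (hGp ω hω)]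
  have hae : ∀ᵐ ω ∂P, (pushConfig τ ω).1 = ω.1.map (τ ω) := by
    filter_upwards [hGae] with ω hω using hpush ω hω
  have hmeas : AEMeasurable (pushConfig τ) P := by
    -- The measurable version is the empty configuration off `G`; `pushConfig` itself may differ
    -- there.
    refine ⟨fun ω => if ω ∈ G then pushConfig τ ω else ⟨0, isPointMeasure_zero⟩, ?_, ?_⟩
    · refine measurable_configuration fun B hB => ?_
      have : (fun ω => (if ω ∈ G then pushConfig τ ω else ⟨0, isPointMeasure_zero⟩ :
          Configuration Y).1 B) = fun ω => if ω ∈ G then ω.1.map (τ ω) B else 0 := by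
        ext ω
        split_ifs with h
        · rw [hpush ω h]
        · rfl
      rw [this]
      exact Measurable.ite hG (measurable_map_transform_apply hτ_meas hB) measurable_const
    · filter_upwards [hGae] with ω hω
      rw [if_pos hω]
  have hprob : IsProbabilityMeasure (P.map (pushConfig τ)) := Measure.isProbabilityMeasure_map hmeas
  -- The joint law carries everything: its case `p = 1` gives the Poisson marginals, and its product
  -- form gives independence.
  have hlaw : ∀ {p : ℕ} {B : Fin p → Set Y}, (∀ i, MeasurableSet (B i)) → (∀ i, μ (B i) ≠ ∞) →
      Pairwise (fun i j => Disjoint (B i) (B j)) →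
      (P.map (pushConfig τ)).map (fun ξ i => ξ.1 (B i)) = Measure.pi fun i =>
        (poissonMeasure (μ (B i)).toNNReal).map (fun n : ℕ => (n : ℝ≥0∞)) := by
    intro p B hB hfin hd
    rw [← hP.map_transform_eq_pi hτ_meas hτ_map hτ_cyclic hB hfin hd,
      AEMeasurable.map_map_of_aemeasurable
        (measurable_pi_lambda _ fun i => measurable_eval (hB i)).aemeasurable hmeas]
    refine Measure.map_congr ?_
    filter_upwards [hae] with ω hω
    ext i
    simp only [Function.comp_apply, hω]
  have hmarg : ∀ B : Set Y, MeasurableSet B → μ B ≠ ∞ →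
      (P.map (pushConfig τ)).map (fun ξ => ξ.1 B) =
        (poissonMeasure (μ B).toNNReal).map (fun n : ℕ => (n : ℝ≥0∞)) := by
    intro B hB hfin
    have h := hlaw (p := 1) (B := fun _ => B) (fun _ => hB) (fun _ => hfin)
      fun i j hij => absurd (Subsingleton.elim i j) hij
    rw [← (measurePreserving_eval (fun _ : Fin 1 =>
      (poissonMeasure (μ B).toNNReal).map (fun n : ℕ => (n : ℝ≥0∞))) 0).map_eq, ← h,
      Measure.map_map (measurable_pi_apply _)
        (measurable_pi_lambda _ fun _ => measurable_eval hB)]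
    rfl
  refine ⟨hae, hmeas, hprob, hmarg, fun p B hB hfin hd => ?_⟩
  rw [iIndepFun_iff_map_fun_eq_pi_map fun i => (measurable_eval (hB i)).aemeasurable,
    hlaw hB hfin hd]
  congr 1
  ext1 i
  exact (hmarg _ (hB i) (hfin i)).symm
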